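/- **Setting.** A stochastic arena $G=((V,E),(V_\exists,V_\forall,V_R),\Delta)$ consists of a finite directed graph $(V,E)$ in which every vertex has a successor, a partition $V=V_\exists\uplus V_\forall\uplus V_R$ into vertices of Eve, vertices of Adam and random vertices, and for each $u\in V_R$ a probability distribution $\Delta(u,\cdot)$ on $V$ with support $\{w\mid (u,w)\in E\}$. A strategy of Eve (Adam) assigns to each finite word over $V$ ending in a vertex $v\in V_\exists$ ($v\in V_\forall$) a distribution on the successors of $v$; it is pure memoryless if it chooses one successor deterministically, depending only on $v$. $\Sigma_\exists$ and $\Sigma_\forall$ are the sets of pure memoryless strategies of Eve and Adam. Strategies $\sigma,\gamma$ and a starting vertex $v$ induce a probability measure $\mathbb P^v_{\sigma,\gamma}$ on infinite sequences of vertices. For an objective $\Phi$ (a set of plays, i.e. of infinite paths of the graph), a strategy $\sigma$ of Eve is optimal from $v$ if $\inf_\gamma\mathbb P^v_{\sigma,\gamma}(\Phi)=\sup_{\sigma'}\inf_\gamma\mathbb P^v_{\sigma',\gamma}(\Phi)$, where the suprema and infima range over all strategies; a strategy $\gamma$ of Adam is optimal from $v$ if $\inf_\sigma\mathbb P^v_{\sigma,\gamma}(\Phi^c)=\sup_{\gamma'}\inf_\sigma\mathbb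 P^v_{\sigma,\gamma'}(\Phi^c)$, where $\Phi^c$ is the set of plays outside $\Phi$. Let $p:V\to\mathbb N$ be a priority function. The stochastic parity game $(G,\mathrm{PA}(p))$ has as objective the set of plays for which the least priority seen infinitely often is even. Let $\alpha:\mathbb N\to[0,1]$. The gadget arena $\widetilde G$ has vertices $\overline v,\widehat v$ $(v\in V)$, $v_{\mathrm{win}}$ and $v_{\mathrm{lose}}$. Vertex $\overline v$ has the owner of $v$; all other vertices are random. For every $(u,w)\in E$ there is an edge $\overline u\to\widehat w$, with probability $\Delta(u,w)$ if $u\in V_R$; from $\widehat w$ one moves to $\overline w$ with probability $1-\alpha_{p(w)}$, and with probability $\alpha_{p(w)}$ to $v_{\mathrm{win}}$ if $p(w)$ is even, to $v_{\mathrm{lose}}$ if $p(w)$ is odd; $v_{\mathrm{win}}$ and $v_{\mathrm{lose}}$ are absorbing. The simple stochastic game $(\widetilde G,\mathrm{RE}(v_{\mathrm{win}}))$ has as objective the set of plays that visit $v_{\mathrm{win}}$. Pure memoryless strategies of $G$ and of $\widetilde G$ are identified (moving from $u$ to $w$ in $G$ corresponds to moving from $\overline u$ to $\widehat w$ in $\widetilde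 G$). Write $\widetilde{\Pr}$ for probabilities in $\widetilde G$. For $(\sigma,\gamma)\in\Sigma_\exists\times\Sigma_\forall$ let $\mathcal M_{\sigma,\gamma}$ be the Markov chain on $V$ that they induce on $G$. A BSCC of $\mathcal M_{\sigma,\gamma}$ is a maximal strongly connected set of states that no transition leaves; the associated pBSCC is $\widetilde U=\{\overline u,\widehat u\mid u\in U\}$. Let $\widetilde{\Pr}^{\overline v}_{\sigma,\gamma}(\mathit{crossPath})$ be the probability to reach some pBSCC from $\overline v$. For a BSCC $U$ with $\min p(U)$ even let $\widetilde{\Pr}^{U}_{\sigma,\gamma}(\mathit{winEven})=\min_{x\in\widetilde U}\widetilde{\Pr}^{x}_{\sigma,\gamma}(\text{reach }v_{\mathrm{win}})$, and for a BSCC $U$ with $\min p(U)$ odd let $\widetilde{\Pr}^{U}_{\sigma,\gamma}(\mathit{winOdd})=\max_{x\in\widetilde U}\widetilde{\Pr}^{x}_{\sigma,\gamma}(\text{reach }v_{\mathrm{win}})$. Assume that $\Delta(u,w)=a_{u,w}/b_{u,w}$ for all $u\in V_R$, $w\in V$, with $a_{u,w}\in\mathbb N$ and $b_{u,w}\in\mathbb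 N_+$. Put $b_{u,w}=1$ for $u\notin V_R$ and let $M=\max_{(u,w)\in E}b_{u,w}$, $n=|V|$ and $\varepsilon=\dfrac1{(n!)^2M^{2n^2}}$. **Theorem (Reducing SPGs to SSGs).** Suppose that for all $(\sigma,\gamma)\in\Sigma_\exists\times\Sigma_\forall$: 1. $\widetilde{\Pr}^{\overline v}_{\sigma,\gamma}(\mathit{crossPath})>\frac{4-\varepsilon}{4}$ for all $v\in V$; 2. $\widetilde{\Pr}^{U}_{\sigma,\gamma}(\mathit{winEven})\ge\frac{4}{4+\varepsilon}$ for every BSCC $U$ of $\mathcal M_{\sigma,\gamma}$ with $\min p(U)$ even, and $\widetilde{\Pr}^{U}_{\sigma,\gamma}(\mathit{winOdd})\le1-\frac{4}{4+\varepsilon}$ for every BSCC $U$ of $\mathcal M_{\sigma,\gamma}$ with $\min p(U)$ odd. Then every pure memoryless strategy of Eve that is optimal in $(\widetilde G,\mathrm{RE}(v_{\mathrm{win}}))$ is optimal in $(G,\mathrm{PA}(p))$, and the same holds for Adam. More precisely, for every $v\in V$, a pure memoryless strategy of Eve (of Adam) that is optimal from $\overline v$ in the former game is optimal from $v$ in the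 latter. -/

import Mathlib

open MeasureTheory ProbabilityTheory
open scoped ENNReal

/-- The two players. -/
inductive Player
  | eve
  | adam

/-- A stochastic arena on the vertex set `V`: a directed graph without dead ends, whose vertices are
partitioned into those of Eve (`owner v = some .eve`), those of Adam (`owner v = some .adam`) and
the random ones (`owner v = none`); a random vertex `u` carries a probability distribution on `V`
whose support is the set of successors of `u`. -/
structure StochasticArena (V : Type*) where
  owner : V → Option Player
  edge : V → V → Prop
  prob : ∀ u, owner u = none → PMF V
  edge_iff_of_random : ∀ u (hu : owner u = none) w, edge u w ↔ w ∈ (prob u hu).support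
  nonblocking : ∀ u, ∃ w, edge u w

namespace StochasticArena

variable {V : Type*}

/-- Nonempty words `v₀ v₁ … vₙ` over `V`. -/
abbrev History (V : Type*) (n : ℕ) : Type _ := Finset.Iic n → V

/-- The last letter `vₙ` of the word `v₀ v₁ … vₙ`. -/
def History.last {n : ℕ} (h : History V n) : V := h ⟨n, Finset.mem_Iic.2 le_rfl⟩

/-- A (history-dependent, randomized) strategy of player `P`: it assigns a distribution on the
successors of `vₙ` to every word `v₀ … vₙ` that ends in a vertex of `P`. -/
structure Strategy (G : StochasticArena V) (P : Player) where
  move : ∀ (n : ℕ) (h : History V n), G.owner h.last = some P → PMF V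
  edge_of_mem_support : ∀ n h hP, ∀ w ∈ (move n h hP).support, G.edge h.last w

/-- A pure memoryless strategy of player `P`: a choice of one successor for each vertex of `P`. -/
@[ext]
structure PureStrategy (G : StochasticArena V) (P : Player) where
  next : {v : V // G.owner v = some P} → V
  edge_next : ∀ v, G.edge v.1 (next v)

/-- A pure memoryless strategy, seen as a strategy. -/
noncomputable def PureStrategy.toStrategy {G : StochasticArena V} {P : Player}
    (σ : G.PureStrategy P) : G.Strategy P where
  move _ h hP := PMF.pure (σ.next ⟨h.last, hP⟩)
  edge_of_mem_support _ h hP w hw := by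
    rw [PMF.support_pure, Set.mem_singleton_iff] at hw
    subst hw
    exact σ.edge_next ⟨h.last, hP⟩

/-- The distribution of the vertex that follows the history `h` when Eve plays `σ` and Adam `γ`. -/
noncomputable def nextDist (G : StochasticArena V) (σ : G.Strategy .eve) (γ : G.Strategy .adam)
    {n : ℕ} (h : History V n) : PMF V :=
  match hv : G.owner h.last with
  | some .eve => σ.move n h hv
  | some .adam => γ.move n h hv
  | none => G.prob h.last hv

section Measure

variable [Finite V] [MeasurableSpace V] [DiscreteMeasurableSpace V]

/-- The transition kernel at time `n`. -/
noncomputable def stepKernel (G : StochasticArena V) (σ : G.Strategy .eve) (γ : G.Strategy .adam)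
    (n : ℕ) : Kernel (Finset.Iic n → V) V :=
  Kernel.ofFunOfCountable fun h => (G.nextDist σ γ (n := n) h).toMeasure

instance (G : StochasticArena V) (σ : G.Strategy .eve) (γ : G.Strategy .adam) (n : ℕ) :
    IsMarkovKernel (G.stepKernel σ γ n) :=
  ⟨fun h => PMF.toMeasure.isProbabilityMeasure (G.nextDist σ γ (n := n) h)⟩

/-- The law, on the infinite sequences of vertices, of the play that starts in `v` when Eve follows
`σ` and Adam follows `γ`. -/
noncomputable def playMeasure (G : StochasticArena V) (σ : G.Strategy .eve) (γ : G.Strategy .adam)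
    (v : V) : Measure (ℕ → V) :=
  Kernel.traj (X := fun _ => V) (G.stepKernel σ γ) 0 (fun _ => v)

end Measure

/-- The plays: infinite sequences of vertices that follow the edges. -/
def plays (G : StochasticArena V) : Set (ℕ → V) := {π | ∀ i, G.edge (π i) (π (i + 1))}

/-- The reachability objective with target set `T`. -/
def reachObj (G : StochasticArena V) (T : Set V) : Set (ℕ → V) := {π ∈ G.plays | ∃ k, π k ∈ T}

/-- The vertices that occur infinitely often in a sequence. -/
def infSet (π : ℕ → V) : Set V := {v | ∀ n, ∃ k, π (n + k) = v}

/-- The parity objective of a priority function: the smallest priority that is seen infinitely often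
is even. -/
def parityObj (G : StochasticArena V) (p : V → ℕ) : Set (ℕ → V) :=
  {π ∈ G.plays | Even (sInf (p '' infSet π))}

section Value

variable [Finite V] [MeasurableSpace V] [DiscreteMeasurableSpace V]

/-- Eve's value of `v` for the objective `Φ` (all strategies of both players are allowed). -/
noncomputable def valueEve (G : StochasticArena V) (Φ : Set (ℕ → V)) (v : V) : ℝ≥0∞ :=
  ⨆ σ : G.Strategy .eve, ⨅ γ : G.Strategy .adam, G.playMeasure σ γ v Φ

/-- Adam's value of `v` when Eve's objective is `Φ`; Adam's own objective consists of the plays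
outside `Φ`. -/
noncomputable def valueAdam (G : StochasticArena V) (Φ : Set (ℕ → V)) (v : V) : ℝ≥0∞ :=
  ⨆ γ : G.Strategy .adam, ⨅ σ : G.Strategy .eve, G.playMeasure σ γ v (G.plays \ Φ)

/-- Eve's strategy `σ` is optimal from `v`, when Eve's objective is `Φ`. -/
def OptimalEve (G : StochasticArena V) (Φ : Set (ℕ → V)) (σ : G.Strategy .eve) (v : V) : Prop :=
  ⨅ γ : G.Strategy .adam, G.playMeasure σ γ v Φ = G.valueEve Φ v

/-- Adam's strategy `γ` is optimal from `v`, when Eve's objective is `Φ`. -/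
def OptimalAdam (G : StochasticArena V) (Φ : Set (ℕ → V)) (γ : G.Strategy .adam) (v : V) : Prop :=
  ⨅ σ : G.Strategy .eve, G.playMeasure σ γ v (G.plays \ Φ) = G.valueAdam Φ v

end Value

/-- The transition function of the Markov chain that results from a pair of pure memoryless
strategies. -/
noncomputable def chain (G : StochasticArena V) (σ : G.PureStrategy .eve)
    (γ : G.PureStrategy .adam) (u : V) : PMF V :=
  match hu : G.owner u with
  | some .eve => PMF.pure (σ.next ⟨u, hu⟩)
  | some .adam => PMF.pure (γ.next ⟨u, hu⟩)
  | none => G.prob u hu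

/-- Under pure memoryless strategies, the play is a run of the Markov chain `chain`. -/
theorem nextDist_toStrategy (G : StochasticArena V) (σ : G.PureStrategy .eve)
    (γ : G.PureStrategy .adam) {n : ℕ} (h : History V n) :
    G.nextDist σ.toStrategy γ.toStrategy h = G.chain σ γ h.last := rfl

end StochasticArena

/-- `L` is strongly connected for the transition function `δ`: any two of its states are mutually
reachable, in at least one step. -/
def StronglyConnected {V : Type*} (δ : V → PMF V) (L : Set V) : Prop :=
  ∀ u ∈ L, ∀ w ∈ L, Relation.TransGen (fun x y => y ∈ (δ x).support) u w

/-- Bottom strongly connected components of a Markov chain: (nonempty) maximal strongly connected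
sets which no transition leaves. -/
structure IsBSCC {V : Type*} (δ : V → PMF V) (L : Set V) : Prop where
  nonempty : L.Nonempty
  stronglyConnected : StronglyConnected δ L
  maximal : ∀ L', StronglyConnected δ L' → L ⊆ L' → L' = L
  closed : ∀ u ∈ L, ∀ w ∈ (δ u).support, w ∈ L

/-- The vertices of the gadget: two copies `bar v` and `hat v` of each vertex `v`, and two sinks. -/
inductive GadgetVertex (V : Type*)
  | bar (v : V)
  | hat (v : V)
  | win
  | lose

namespace GadgetVertex

variable {V : Type*}

instance [Finite V] : Finite (GadgetVertex V) :=
  Finite.of_injective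
    (fun x : GadgetVertex V => match x with
      | bar v => (Sum.inl (Sum.inl v) : (V ⊕ V) ⊕ Bool)
      | hat v => Sum.inl (Sum.inr v)
      | win => Sum.inr true
      | lose => Sum.inr false)
    (by intro x y; cases x <;> cases y <;> simp)

instance : MeasurableSpace (GadgetVertex V) := ⊤

instance : DiscreteMeasurableSpace (GadgetVertex V) := ⟨fun _ => trivial⟩

/-- The sink attached to the priority `k`: winning if `k` is even, losing if `k` is odd. -/
def sink (k : ℕ) : GadgetVertex V := if Even k then win else lose

/-- The two copies of the vertices in `U`. -/
def tilde (U : Set V) : Set (GadgetVertex V) := bar '' U ∪ hat '' U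

end GadgetVertex

/-- The biased coin that shows `true` with probability `q`. -/
noncomputable def coin (q : unitInterval) : PMF Bool :=
  PMF.ofFintype (fun b => cond b (ENNReal.ofReal q) (ENNReal.ofReal (1 - q))) (by
    rw [Fintype.sum_bool]
    simp only [cond_true, cond_false]
    rw [← ENNReal.ofReal_add q.2.1 (sub_nonneg.2 q.2.2)]
    simp)

/-- The distribution which gives `x` the probability `q` and `y` the probability `1 - q`. -/
noncomputable def mix {W : Type*} (q : unitInterval) (x y : W) : PMF W :=
  (coin q).map fun b => if b then x else y

theorem mem_support_mix {W : Type*} (q : unitInterval) (x y z : W) :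
    z ∈ (mix q x y).support ↔ (z = x ∧ (q : ℝ) ≠ 0) ∨ (z = y ∧ (q : ℝ) ≠ 1) := by
  have h0 : (0 : ℝ) < q ↔ (q : ℝ) ≠ 0 := ⟨fun h => h.ne', fun h => lt_of_le_of_ne q.2.1 h.symm⟩
  have h1 : (q : ℝ) < 1 ↔ (q : ℝ) ≠ 1 := ⟨fun h => h.ne, fun h => lt_of_le_of_ne q.2.2 h⟩
  rw [mix, PMF.mem_support_map_iff]
  simp only [Bool.exists_bool, PMF.mem_support_iff, coin, PMF.ofFintype_apply, cond_true,
    cond_false, ne_eq, ENNReal.ofReal_eq_zero, not_le, sub_pos, h0, h1, if_true,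
    Bool.false_eq_true, if_false]
  constructor
  · rintro (⟨h, rfl⟩ | ⟨h, rfl⟩) <;> tauto
  · rintro (⟨rfl, h⟩ | ⟨rfl, h⟩) <;> tauto

namespace StochasticArena

variable {V : Type*}

open GadgetVertex

/-- The arena of the gadget. A move from `u` to `w` in `G` becomes a move from `bar u` to `hat w`,
and from the random vertex `hat w` the play goes to the sink attached to the priority `p w` with
probability `α (p w)` and to `bar w` with probability `1 - α (p w)`. -/
noncomputable def gadget (G : StochasticArena V) (p : V → ℕ) (α : ℕ → unitInterval) :
    StochasticArena (GadgetVertex V) where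
  owner
    | bar v => G.owner v
    | _ => none
  edge
    | bar u, y => ∃ w, G.edge u w ∧ hat w = y
    | hat u, y => (y = sink (p u) ∧ (α (p u) : ℝ) ≠ 0) ∨ (y = bar u ∧ (α (p u) : ℝ) ≠ 1)
    | win, y => y = win
    | lose, y => y = lose
  prob
    | bar u, hu => (G.prob u hu).map hat
    | hat u, _ => mix (α (p u)) (sink (p u)) (bar u)
    | win, _ => PMF.pure win
    | lose, _ => PMF.pure lose
  edge_iff_of_random
    | bar u, hu, y => by
        rw [PMF.mem_support_map_iff]
        simp only [G.edge_iff_of_random u hu]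
    | hat u, _, y => (mem_support_mix _ _ _ _).symm
    | win, _, y => by simp
    | lose, _, y => by simp
  nonblocking
    | bar u => by
        obtain ⟨w, hw⟩ := G.nonblocking u
        exact ⟨hat w, w, hw, rfl⟩
    | hat u => by
        by_cases h : (α (p u) : ℝ) = 0
        · exact ⟨bar u, Or.inr ⟨rfl, by rw [h]; exact zero_ne_one⟩⟩
        · exact ⟨sink (p u), Or.inl ⟨rfl, h⟩⟩
    | win => ⟨win, rfl⟩
    | lose => ⟨lose, rfl⟩

/-- A pure memoryless strategy in `G`, seen as one in the gadget: it moves from `bar u` to `hat w`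
if it moves from `u` to `w` in `G`. -/
def PureStrategy.lift {G : StochasticArena V} {P : Player} (σ : G.PureStrategy P)
    (p : V → ℕ) (α : ℕ → unitInterval) : (G.gadget p α).PureStrategy P where
  next
    | ⟨bar u, hu⟩ => hat (σ.next ⟨u, hu⟩)
    | ⟨hat _, hu⟩ => nomatch hu
    | ⟨win, hu⟩ => nomatch hu
    | ⟨lose, hu⟩ => nomatch hu
  edge_next
    | ⟨bar u, hu⟩ => ⟨_, σ.edge_next ⟨u, hu⟩, rfl⟩
    | ⟨hat _, hu⟩ => nomatch hu
    | ⟨win, hu⟩ => nomatch hu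
    | ⟨lose, hu⟩ => nomatch hu

/-- Pure memoryless strategies in `G` and in the gadget correspond one to one. -/
theorem PureStrategy.lift_bijective (G : StochasticArena V) (P : Player) (p : V → ℕ)
    (α : ℕ → unitInterval) :
    Function.Bijective fun σ : G.PureStrategy P => σ.lift p α := by
  constructor
  · rintro ⟨f, hf⟩ ⟨g, hg⟩ h
    have h' : ∀ v : {v : V // G.owner v = some P}, f v = g v := by
      intro v
      have := congrArg (fun τ => τ.next ⟨bar v.1, v.2⟩) h
      exact GadgetVertex.hat.inj this
    obtain rfl : f = g := funext h'
    rfl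
  · rintro ⟨f, hf⟩
    choose g hg using fun v : {v : V // G.owner v = some P} => hf ⟨bar v.1, v.2⟩
    refine ⟨⟨g, fun v => (hg v).1⟩, ?_⟩
    have h' : ((⟨g, fun v => (hg v).1⟩ : G.PureStrategy P).lift p α).next = f := by
      funext x
      obtain ⟨x, hx⟩ := x
      cases x with
      | bar v => exact (hg ⟨v, hx⟩).2
      | hat v => exact nomatch hx
      | win => exact nomatch hx
      | lose => exact nomatch hx
    exact PureStrategy.ext h'

section Gadget

variable [Finite V]

/-- The law of the play from `x` in the gadget when the players follow `σ` and `γ`. -/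
noncomputable def gadgetMeasure (G : StochasticArena V) (p : V → ℕ) (α : ℕ → unitInterval)
    (σ : G.PureStrategy .eve) (γ : G.PureStrategy .adam) (x : GadgetVertex V) :
    Measure (ℕ → GadgetVertex V) :=
  (G.gadget p α).playMeasure (σ.lift p α).toStrategy (γ.lift p α).toStrategy x

/-- The probability to reach, from `bar v`, a pBSCC: the two copies of a BSCC of the Markov chain
that `σ` and `γ` induce on `G`. -/
noncomputable def crossPath (G : StochasticArena V) (p : V → ℕ) (α : ℕ → unitInterval)
    (σ : G.PureStrategy .eve) (γ : G.PureStrategy .adam) (v : V) : ℝ≥0∞ :=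
  G.gadgetMeasure p α σ γ (bar v) {π | ∃ U, IsBSCC (G.chain σ γ) U ∧ ∃ i, π i ∈ tilde U}

/-- The minimal probability to reach the winning sink from the two copies of `U`. -/
noncomputable def winEven (G : StochasticArena V) (p : V → ℕ) (α : ℕ → unitInterval)
    (σ : G.PureStrategy .eve) (γ : G.PureStrategy .adam) (U : Set V) : ℝ≥0∞ :=
  ⨅ x ∈ tilde U, G.gadgetMeasure p α σ γ x {π | ∃ i, π i = win}

/-- The maximal probability to reach the winning sink from the two copies of `U`. -/
noncomputable def winOdd (G : StochasticArena V) (p : V → ℕ) (α : ℕ → unitInterval)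
    (σ : G.PureStrategy .eve) (γ : G.PureStrategy .adam) (U : Set V) : ℝ≥0∞ :=
  ⨆ x ∈ tilde U, G.gadgetMeasure p α σ γ x {π | ∃ i, π i = win}

end Gadget

open Classical in
/-- The largest denominator `b u w` on an edge `(u, w)`, where the moves of the players count with
the denominator `1`. -/
noncomputable def maxDenom [Fintype V] (G : StochasticArena V) (b : V → V → ℕ) : ℕ :=
  Finset.univ.sup fun e : V × V =>
    if G.edge e.1 e.2 then (if G.owner e.1 = none then b e.1 e.2 else 1) else 0

/-- The number `ε = 1 / ((n!)² M ^ (2 n²))`. -/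
noncomputable def epsilon (n M : ℕ) : ℝ :=
  1 / ((n.factorial : ℝ) ^ 2 * (M : ℝ) ^ (2 * n ^ 2))

end StochasticArena

/-! Fix pure memoryless strategies of both players. In the gadget the play enters the copies of a
BSCC with probability above `1 - ε/4`, and from there it reaches the winning sink with probability
within `ε/4` of 1 or 0, depending on the parity of the class. So the winning probability in the
gadget and the parity probability in `G` differ by less than `ε/2` (`abs_winProb_sub_parityVal_lt`).
On the other hand, the parity probabilities solve a nonsingular linear system whose rows have
denominators at most `M ^ n`. Cramer's rule yields a denominator at most `L = n! M ^ (n²)`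
(`exists_denominator_chain`), so two distinct parity probabilities, even for different pairs of
strategies, are at least `1 / L² = ε` apart. Hence a weak inequality between winning probabilities
in the gadget forces the same weak inequality between parity probabilities.

An optimal strategy in the gadget forms a saddle point with some pure memoryless strategy of the
opponent, because reachability games have pure memoryless saddle points (`exists_reach_saddle`:
discount, then let the discount factor tend to 1). The comparison above carries the saddle
inequality over to the pure memoryless strategies of `G`. It extends to all strategies, because
against a fixed pure memoryless strategy the opponent faces a Markov decision process with a parity
objective, where some pure memoryless policy is optimal (`exists_optimal_pureChain`, by policy
improvement).

The probabilistic input is small: a one-step expectation formula, optional stopping for sub- and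
superharmonic functions, and the fact that the states visited infinitely often almost surely form a
BSCC (`ae_isBSCC_infSet`). -/

namespace StochasticArena

open Filter Topology

set_option linter.unusedSectionVars false

/-! ### Histories and adapted functions -/

section Histories

variable {V : Type*}

/-- The history of a sequence up to time `n`. -/
def hist (n : ℕ) (π : ℕ → V) : History V n := Preorder.frestrictLe n π

@[simp]
theorem last_hist (n : ℕ) (π : ℕ → V) : (hist n π).last = π n := rfl

/-- Extend a history to an infinite sequence by repeating its last letter. -/
def History.extend {n : ℕ} (h : History V n) (i : ℕ) : V :=
  if hi : i ≤ n then h ⟨i, Finset.mem_Iic.2 hi⟩ else h.last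

theorem extend_hist {n i : ℕ} (π : ℕ → V) (hi : i ≤ n) : (hist n π).extend i = π i := by
  simp [History.extend, hi, hist]

/-- `F π` depends only on the letters of `π` up to time `n`. -/
def Adapted {β : Type*} (n : ℕ) (F : (ℕ → V) → β) : Prop :=
  ∀ π π' : ℕ → V, (∀ i ≤ n, π i = π' i) → F π = F π'

theorem Adapted.eq_hist {β : Type*} {n : ℕ} {F : (ℕ → V) → β} (hF : Adapted n F) :
    F = (fun h : History V n => F h.extend) ∘ hist n :=
  funext fun π => hF _ _ fun _ hi => (extend_hist π hi).symm

theorem adapted_hist {β : Type*} {n : ℕ} (F : History V n → β) : Adapted n (F ∘ hist n) := by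
  intro π π' h
  have : hist n π = hist n π' := by
    funext i
    exact h i.1 (Finset.mem_Iic.1 i.2)
  simp [this]

theorem measurable_hist [MeasurableSpace V] (n : ℕ) : Measurable (hist (V := V) n) :=
  Preorder.measurable_frestrictLe n

end Histories

/-! ### Trajectory measures of history-dependent policies -/

section Policy

variable {V : Type*} [Finite V] [MeasurableSpace V] [DiscreteMeasurableSpace V]

/-- The kernel of a policy, that is of a rule which chooses the law of the next state as a function
of the history. -/
noncomputable def policyKernel (δ : ∀ n, History V n → PMF V) (n : ℕ) :
    Kernel (Finset.Iic n → V) V :=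
  Kernel.ofFunOfCountable fun h => (δ n h).toMeasure

instance (δ : ∀ n, History V n → PMF V) (n : ℕ) : IsMarkovKernel (policyKernel δ n) :=
  ⟨fun h => PMF.toMeasure.isProbabilityMeasure (δ n h)⟩

/-- The law of the run of a policy from the state `v`. -/
noncomputable def policyMeasure (δ : ∀ n, History V n → PMF V) (v : V) : Measure (ℕ → V) :=
  Kernel.traj (X := fun _ => V) (policyKernel δ) 0 (fun _ => v)

instance (δ : ∀ n, History V n → PMF V) (v : V) : IsProbabilityMeasure (policyMeasure δ v) :=
  inferInstanceAs (IsProbabilityMeasure (Kernel.traj (X := fun _ => V) (policyKernel δ) 0 _))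

theorem playMeasure_eq_policyMeasure (G : StochasticArena V) (σ : G.Strategy .eve)
    (γ : G.Strategy .adam) (v : V) :
    G.playMeasure σ γ v = policyMeasure (fun _ h => G.nextDist σ γ h) v := rfl

theorem Adapted.measurable {β : Type*} [MeasurableSpace β] {n : ℕ} {F : (ℕ → V) → β}
    (hF : Adapted n F) : Measurable F := by
  rw [hF.eq_hist]
  exact (measurable_of_countable _).comp (measurable_hist n)

theorem Adapted.integrable {n : ℕ} {F : (ℕ → V) → ℝ} (hF : Adapted n F) (μ : Measure (ℕ → V))
    [IsFiniteMeasure μ] : Integrable F μ := by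
  rw [hF.eq_hist]
  exact (Integrable.of_finite (μ := μ.map (hist n))).comp_measurable (measurable_hist n)

/-- Tower property: given the history up to time `n`, the past in `ψ` is frozen and only the next
letter is random. Together with `ae_policyMeasure_zero` this is all that later arguments need from
the construction of the trajectory measure. -/
theorem integral_policyMeasure_succ (δ : ∀ n, History V n → PMF V) (v : V) (n : ℕ)
    (ψ : (ℕ → V) → V → ℝ) (hψ : Adapted n ψ) :
    ∫ π, ψ π (π (n + 1)) ∂policyMeasure δ v =
      ∫ π, ∫ w, ψ π w ∂(δ n (hist n π)).toMeasure ∂policyMeasure δ v := by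
  have had : Adapted (n + 1) fun π => ψ π (π (n + 1)) := by
    intro π π' h
    simp only [hψ π π' fun i hi => h i (hi.trans n.le_succ), h (n + 1) le_rfl]
  have hint := had.integrable (policyMeasure δ v)
  unfold policyMeasure at hint ⊢
  rw [← Kernel.integral_traj_partialTraj (Nat.zero_le n) hint,
    ← Kernel.traj_map_frestrictLe_apply, integral_map
      (Preorder.measurable_frestrictLe n).aemeasurable
      (measurable_of_countable _).aestronglyMeasurable]
  refine integral_congr_ae (.of_forall fun π => ?_)
  have key : ∀ y : ℕ → V, ψ (Function.updateFinset y (Finset.Iic n) (hist n π)) = ψ π := by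
    intro y
    refine hψ _ _ fun i hi => ?_
    simp [Function.updateFinset, hi, hist]
  have h1 : ∫ y, ψ y (y (n + 1)) ∂Kernel.traj (X := fun _ => V) (policyKernel δ) n (hist n π) =
      ∫ y, ψ π (y (n + 1)) ∂Kernel.traj (X := fun _ => V) (policyKernel δ) n (hist n π) := by
    rw [Kernel.integral_traj (X := fun _ => V) _ had.measurable.aestronglyMeasurable]
    refine integral_congr_ae (.of_forall fun y => ?_)
    refine (congrFun (key y) _).trans ?_
    simp [Function.updateFinset]
  refine h1.trans ?_
  have h2 := DFunLike.congr_fun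
    (Kernel.map_traj_succ_self (X := fun _ => V) (κ := policyKernel δ) (a := n)) (hist n π)
  rw [Kernel.map_apply _ (measurable_pi_apply (n + 1))] at h2
  have h3 : policyKernel δ n (hist n π) = (δ n (hist n π)).toMeasure := rfl
  change _ = ∫ w, ψ π w ∂(δ n (hist n π)).toMeasure
  rw [← h3, ← h2, integral_map (measurable_pi_apply (n + 1)).aemeasurable
    (measurable_of_countable _).aestronglyMeasurable]

theorem ae_policyMeasure_zero (δ : ∀ n, History V n → PMF V) (v : V) :
    ∀ᵐ π ∂policyMeasure δ v, π 0 = v := by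
  have h := Kernel.traj_map_frestrictLe_apply (X := fun _ => V) (κ := policyKernel δ) 0 0
    (fun _ => v)
  rw [Kernel.partialTraj_self, Kernel.id_apply] at h
  have h' : ∀ᵐ x ∂((policyMeasure δ v).map (Preorder.frestrictLe (π := fun _ => V) 0)),
      x = fun _ => v := by
    unfold policyMeasure
    rw [h, ae_dirac_iff (MeasurableSet.of_discrete)]
  have h'' := ae_of_ae_map (Preorder.measurable_frestrictLe 0).aemeasurable h'
  filter_upwards [h''] with π hπ
  exact congrFun hπ ⟨0, by simp⟩

theorem integral_policyMeasure_zero (δ : ∀ n, History V n → PMF V) (v : V) (f : V → ℝ) :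
    ∫ π, f (π 0) ∂policyMeasure δ v = f v := by
  rw [integral_congr_ae (g := fun _ => f v)]
  · simp
  · filter_upwards [ae_policyMeasure_zero δ v] with π hπ
    rw [hπ]

theorem ae_policyMeasure_mem_support (δ : ∀ n, History V n → PMF V) (v : V) :
    ∀ᵐ π ∂policyMeasure δ v, ∀ n, π (n + 1) ∈ (δ n (hist n π)).support := by
  rw [ae_all_iff]
  intro n
  classical
  -- Indicator of a next letter outside the support. Its one-step expectation vanishes, so the
  -- nonnegative variable is almost surely zero.
  let χ : (ℕ → V) → V → ℝ :=
    (fun h : History V n => ((δ n h).support)ᶜ.indicator (fun _ => (1 : ℝ))) ∘ hist n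
  have hχ : Adapted n χ := adapted_hist _
  have h := integral_policyMeasure_succ δ v n χ hχ
  have h0 : ∀ π, ∫ w, χ π w ∂(δ n (hist n π)).toMeasure = 0 := by
    intro π
    simp only [χ, Function.comp]
    rw [integral_indicator .of_discrete]
    simp only [integral_const, smul_eq_mul, mul_one]
    rw [measureReal_restrict_apply_univ, Measure.real,
      (PMF.toMeasure_apply_eq_zero_iff _ .of_discrete).2 disjoint_compl_right]
    rfl
  simp only [h0, integral_zero] at h
  have had : Adapted (n + 1) fun π => χ π (π (n + 1)) := by
    intro π π' h
    simp only [hχ π π' fun i hi => h i (hi.trans n.le_succ), h (n + 1) le_rfl]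
  have h' := (integral_eq_zero_iff_of_nonneg
    (fun π => Set.indicator_nonneg (fun _ _ => zero_le_one) _) (had.integrable _)).1 h
  filter_upwards [h'] with π hπ
  by_contra hc
  simp [Set.indicator, hc] at hπ

end Policy

/-! ### Stopped processes and optional stopping -/

section Stopping

variable {V : Type*}

open Classical in
/-- The sequence `π` stopped at the first visit to `T`. -/
noncomputable def stoppedAt (T : Set V) : ℕ → (ℕ → V) → V
  | 0, π => π 0
  | n + 1, π => if stoppedAt T n π ∈ T then stoppedAt T n π else π (n + 1)

theorem adapted_stoppedAt (T : Set V) (n : ℕ) : Adapted n (stoppedAt T n) := by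
  induction n with
  | zero => exact fun π π' h => h 0 le_rfl
  | succ n ih =>
    intro π π' h
    have e := ih π π' fun i hi => h i (hi.trans n.le_succ)
    simp only [stoppedAt, h (n + 1) le_rfl]
    rw [e]

theorem stoppedAt_of_notMem {T : Set V} {n : ℕ} {π : ℕ → V} (h : stoppedAt T n π ∉ T) :
    stoppedAt T n π = π n := by
  cases n with
  | zero => rfl
  | succ n =>
    by_cases h' : stoppedAt T n π ∈ T
    · simp [stoppedAt, h'] at h
    · simp [stoppedAt, h']

theorem exists_stoppedAt_eq (T : Set V) (n : ℕ) (π : ℕ → V) : ∃ k ≤ n, stoppedAt T n π = π k := by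
  induction n with
  | zero => exact ⟨0, le_rfl, rfl⟩
  | succ n ih =>
    by_cases h' : stoppedAt T n π ∈ T
    · obtain ⟨k, hk, h⟩ := ih
      exact ⟨k, hk.trans n.le_succ, by simp [stoppedAt, h', ← h]⟩
    · exact ⟨n + 1, le_rfl, by simp [stoppedAt, h']⟩

theorem stoppedAt_mem_iff {T : Set V} {n : ℕ} {π : ℕ → V} :
    stoppedAt T n π ∈ T ↔ ∃ k ≤ n, π k ∈ T := by
  constructor
  · intro h
    obtain ⟨k, hk, e⟩ := exists_stoppedAt_eq T n π
    exact ⟨k, hk, e ▸ h⟩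
  · induction n with
    | zero =>
      rintro ⟨k, hk, h⟩
      obtain rfl : k = 0 := by omega
      exact h
    | succ n ih =>
      rintro ⟨k, hk, h⟩
      by_cases h' : stoppedAt T n π ∈ T
      · simp [stoppedAt, h']
      · have hk' : k = n + 1 := by
          by_contra hne
          exact h' (ih ⟨k, by omega, h⟩)
        subst hk'
        simpa [stoppedAt, h'] using h

theorem stoppedAt_empty (n : ℕ) (π : ℕ → V) : stoppedAt ∅ n π = π n :=
  stoppedAt_of_notMem (Set.notMem_empty _)

variable [Finite V] [MeasurableSpace V] [DiscreteMeasurableSpace V]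

/-- Optional stopping for supermartingales. The time dependence of `f` accommodates discounting;
`hT` is needed because the clock keeps running after the process has stopped. With `T = ∅` nothing
is stopped. -/
theorem integral_stoppedAt_le (δ : ∀ n, History V n → PMF V) (T : Set V) (f : ℕ → V → ℝ)
    (hT : ∀ n, ∀ x ∈ T, f (n + 1) x ≤ f n x)
    (hf : ∀ n (h : History V n), h.last ∉ T → ∫ w, f (n + 1) w ∂(δ n h).toMeasure ≤ f n h.last)
    (v : V) (n : ℕ) : ∫ π, f n (stoppedAt T n π) ∂policyMeasure δ v ≤ f 0 v := by
  induction n with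
  | zero => exact (integral_policyMeasure_zero δ v (f 0)).le
  | succ n ih =>
    refine le_trans ?_ ih
    classical
    let ψ : (ℕ → V) → V → ℝ := fun π w =>
      f (n + 1) (if stoppedAt T n π ∈ T then stoppedAt T n π else w)
    have hψ : Adapted n ψ := by
      intro π π' h
      simp only [ψ, adapted_stoppedAt T n π π' h]
    have e : (fun π => f (n + 1) (stoppedAt T (n + 1) π)) = fun π => ψ π (π (n + 1)) := by
      funext π
      simp only [ψ, stoppedAt]
    rw [e, integral_policyMeasure_succ δ v n ψ hψ]
    have had : Adapted n fun π => ∫ w, ψ π w ∂(δ n (hist n π)).toMeasure := by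
      intro π π' h
      have h' : δ n (hist n π) = δ n (hist n π') := adapted_hist (δ n) π π' h
      simp only [hψ π π' h, h']
    have had' : Adapted n fun π => f n (stoppedAt T n π) := by
      intro π π' h
      simp only [adapted_stoppedAt T n π π' h]
    refine integral_mono (had.integrable _) (had'.integrable _) fun π => ?_
    by_cases h' : stoppedAt T n π ∈ T
    · simpa [ψ, h'] using hT n _ h'
    · have := hf n (hist n π) (by rwa [last_hist, ← stoppedAt_of_notMem h'])
      simpa [ψ, h', ← stoppedAt_of_notMem h'] using this

theorem le_integral_stoppedAt (δ : ∀ n, History V n → PMF V) (T : Set V) (f : ℕ → V → ℝ)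
    (hT : ∀ n, ∀ x ∈ T, f n x ≤ f (n + 1) x)
    (hf : ∀ n (h : History V n), h.last ∉ T → f n h.last ≤ ∫ w, f (n + 1) w ∂(δ n h).toMeasure)
    (v : V) (n : ℕ) : f 0 v ≤ ∫ π, f n (stoppedAt T n π) ∂policyMeasure δ v := by
  have := integral_stoppedAt_le δ T (fun n x => -f n x) (fun n x hx => neg_le_neg (hT n x hx))
    (fun n h hh => by simpa only [integral_neg] using neg_le_neg (hf n h hh)) v n
  simpa only [integral_neg, neg_le_neg_iff] using this

theorem tendsto_measureReal_stoppedAt_mem (μ : Measure (ℕ → V)) [IsFiniteMeasure μ] (T : Set V) :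
    Tendsto (fun n => μ.real {π | stoppedAt T n π ∈ T}) atTop (𝓝 (μ.real {π | ∃ k, π k ∈ T})) := by
  have e : {π : ℕ → V | ∃ k, π k ∈ T} = ⋃ n, {π | stoppedAt T n π ∈ T} := by
    ext π
    simp only [Set.mem_ofPred_eq, Set.mem_iUnion, stoppedAt_mem_iff]
    exact ⟨fun ⟨k, h⟩ => ⟨k, k, le_rfl, h⟩, fun ⟨_, k, _, h⟩ => ⟨k, h⟩⟩
  rw [e]
  refine (ENNReal.tendsto_toReal (measure_ne_top μ _)).comp (tendsto_measure_iUnion_atTop ?_)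
  intro m n hmn π h
  simp only [Set.mem_ofPred_eq, stoppedAt_mem_iff] at h ⊢
  obtain ⟨k, hk, h⟩ := h
  exact ⟨k, hk.trans hmn, h⟩

theorem measurableSet_stoppedAt_mem (T S : Set V) (n : ℕ) :
    MeasurableSet {π | stoppedAt T n π ∈ S} :=
  (adapted_stoppedAt T n).measurable .of_discrete

theorem measurableSet_reach (T : Set V) : MeasurableSet {π : ℕ → V | ∃ k, π k ∈ T} := by
  rw [Set.ofPred_exists]
  exact .iUnion fun k => measurable_pi_apply k .of_discrete

/-- By the bounds on `g`, the indicator of having been stopped in `T` by time `n` is at most `g` of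
the stopped process, whose mean is at most `g v`; then `n` tends to infinity. -/
theorem measureReal_reach_le (δ : ∀ n, History V n → PMF V) (T : Set V) (g : V → ℝ)
    (h0 : ∀ x, 0 ≤ g x) (hT : ∀ x ∈ T, 1 ≤ g x)
    (hg : ∀ n (h : History V n), h.last ∉ T → ∫ w, g w ∂(δ n h).toMeasure ≤ g h.last) (v : V) :
    (policyMeasure δ v).real {π | ∃ k, π k ∈ T} ≤ g v := by
  refine le_of_tendsto' (tendsto_measureReal_stoppedAt_mem _ T) fun n => ?_
  refine le_trans ?_ (integral_stoppedAt_le δ T (fun _ => g) (fun _ _ _ => le_rfl) hg v n)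
  have had : Adapted n fun π => g (stoppedAt T n π) := by
    intro π π' h
    simp only [adapted_stoppedAt T n π π' h]
  rw [← integral_indicator_one (measurableSet_stoppedAt_mem T T n)]
  refine integral_mono ((integrable_const 1).indicator (measurableSet_stoppedAt_mem T T n))
    (had.integrable _) fun π => ?_
  by_cases h : stoppedAt T n π ∈ T
  · simpa [Set.indicator, h] using hT _ h
  · simpa [Set.indicator, h] using h0 _

end Stopping

/-! ### States visited infinitely often -/

section Recurrence

variable {V : Type*} [Finite V]

theorem infSet_nonempty (π : ℕ → V) : (infSet π).Nonempty := by
  obtain ⟨u, hu⟩ := Finite.exists_infinite_fiber π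
  refine ⟨u, fun n => ?_⟩
  rw [Set.infinite_coe_iff] at hu
  obtain ⟨m, hm, hnm⟩ := hu.exists_gt n
  exact ⟨m - n, by rw [Nat.add_sub_cancel' hnm.le]; exact hm⟩

theorem eventually_mem_infSet (π : ℕ → V) : ∀ᶠ n in atTop, π n ∈ infSet π := by
  have : ∀ u, ∀ᶠ n in atTop, u ∉ infSet π → π n ≠ u := by
    intro u
    by_cases hu : u ∈ infSet π
    · simp [hu]
    · simp only [infSet, Set.mem_ofPred_eq, not_forall, not_exists] at hu
      obtain ⟨N, hN⟩ := hu
      filter_upwards [eventually_ge_atTop N] with n hn _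
      rw [← Nat.add_sub_cancel' hn]
      exact hN _
  rw [← eventually_all] at this
  filter_upwards [this] with n hn
  by_contra h
  exact hn _ h rfl

variable [MeasurableSpace V] [DiscreteMeasurableSpace V]

theorem measurableSet_mem_infSet (u : V) : MeasurableSet {π : ℕ → V | u ∈ infSet π} := by
  have : {π : ℕ → V | u ∈ infSet π} = ⋂ n : ℕ, ⋃ k : ℕ, (fun π => π (n + k)) ⁻¹' {u} := by
    ext π
    simp [infSet]
  rw [this]
  exact .iInter fun n => .iUnion fun k => measurable_pi_apply (n + k) .of_discrete

theorem measurableSet_infSet (P : Set V → Prop) : MeasurableSet {π : ℕ → V | P (infSet π)} := by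
  have hm : ∀ S : Set V, MeasurableSet {π : ℕ → V | infSet π = S} := by
    intro S
    have : {π : ℕ → V | infSet π = S} = ⋂ u, {π | u ∈ infSet π ↔ u ∈ S} := by
      ext π
      simp [Set.ext_iff]
    rw [this]
    refine .iInter fun u => ?_
    by_cases hu : u ∈ S
    · simpa [hu] using measurableSet_mem_infSet u
    · simp only [hu, iff_false]
      exact (measurableSet_mem_infSet u).compl
  have : {π : ℕ → V | P (infSet π)} = ⋃ S ∈ {S : Set V | P S}, {π | infSet π = S} := by
    ext π
    simp
  rw [this]
  exact .biUnion (Set.to_countable _) fun S _ => hm S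

/-- The factor by which the betting strategy of `ae_mem_infSet_of_mem_support` changes its capital
when the play moves from `x` to `y`. -/
noncomputable def bet (N : ℕ) (u w : V) (r : ℝ) (k : ℕ) (x y : V) : ℝ :=
  open Classical in if N ≤ k ∧ x = u then (if y = w then 0 else 1 + r) else 1

/-- At each visit to `u` from time `N` on, the whole capital is staked against a move to `w`: it is
lost with probability `r` and grows by the factor `1 + r` otherwise. The mean factor is `(1 + r)(1 -
r) ≤ 1`. -/
theorem integral_prod_bet_le (δ : ∀ n, History V n → PMF V) (v u w : V) (q : PMF V)
    (hq : ∀ n (h : History V n), h.last = u → δ n h = q) (N n : ℕ) :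
    ∫ π, ∏ k ∈ Finset.range n, bet N u w (q w).toReal k (π k) (π (k + 1)) ∂policyMeasure δ v ≤ 1
    := by
  set r := (q w).toReal with hr
  have hr0 : 0 ≤ r := ENNReal.toReal_nonneg
  have hb0 : ∀ k x y, 0 ≤ bet N u w r k x y := by
    intro k x y
    unfold bet
    split_ifs <;> linarith
  have hprod : ∀ n, Adapted n fun π : ℕ → V => ∏ k ∈ Finset.range n,
      bet N u w r k (π k) (π (k + 1)) := by
    intro n π π' h
    refine Finset.prod_congr rfl fun k hk => ?_
    have := Finset.mem_range.1 hk
    rw [h k this.le, h (k + 1) this]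
  induction n with
  | zero => simp
  | succ n ih =>
    refine le_trans ?_ ih
    let ψ : (ℕ → V) → V → ℝ := fun π y =>
      (∏ k ∈ Finset.range n, bet N u w r k (π k) (π (k + 1))) * bet N u w r n (π n) y
    have hψ : Adapted n ψ := by
      intro π π' h
      funext y
      have e := hprod n π π' h
      simp only at e
      simp only [ψ]
      rw [e, h n le_rfl]
    simp only [Finset.prod_range_succ]
    refine (integral_policyMeasure_succ δ v n ψ hψ).trans_le ?_
    have had : Adapted n fun π => ∫ w, ψ π w ∂(δ n (hist n π)).toMeasure := by
      intro π π' h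
      have h' : δ n (hist n π) = δ n (hist n π') := adapted_hist (δ n) π π' h
      simp only [hψ π π' h, h']
    refine integral_mono (had.integrable _) ((hprod n).integrable _) fun π => ?_
    simp only [ψ]
    rw [integral_const_mul]
    refine mul_le_of_le_one_right (Finset.prod_nonneg fun k _ => hb0 _ _ _) ?_
    by_cases hc : N ≤ n ∧ π n = u
    · rw [hq n (hist n π) hc.2]
      have e : (fun y => bet N u w r n (π n) y) =
          fun y => (1 + r) - (1 + r) * ({w} : Set V).indicator 1 y := by
        funext y
        by_cases hy : y = w <;> simp [bet, hc, hy]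
      rw [e, integral_sub (integrable_const _) (.of_finite), integral_const_mul,
        integral_indicator_one .of_discrete, measureReal_def,
        PMF.toMeasure_apply_singleton _ _ .of_discrete, ← hr]
      simp only [integral_const, probReal_univ, smul_eq_mul]
      nlinarith
    · simp [bet, hc]

/-- If `u` recurs but `w` does not occur from time `N` on, then the bettor who starts at time `N`
becomes infinitely rich, which has probability zero. Only the law of the move out of `u` has to be
independent of the history, so the lemma also applies to the uncontrolled states of a decision
process. -/
theorem ae_mem_infSet_of_mem_support (δ : ∀ n, History V n → PMF V) (v u w : V) (q : PMF V)
    (hq : ∀ n (h : History V n), h.last = u → δ n h = q) (hw : w ∈ q.support) :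
    ∀ᵐ π ∂policyMeasure δ v, u ∈ infSet π → w ∈ infSet π := by
  set r := (q w).toReal with hr
  have hr0 : 0 < r := ENNReal.toReal_pos ((PMF.mem_support_iff q w).1 hw) (q.apply_ne_top w)
  have hb0 : ∀ N k x y, 0 ≤ bet N u w r k x y := by
    intro N k x y
    unfold bet
    split_ifs <;> linarith
  set μ := policyMeasure δ v
  let F : ℕ → ℕ → (ℕ → V) → ℝ := fun N n π =>
    ∏ k ∈ Finset.range n, bet N u w r k (π k) (π (k + 1))
  have hF : ∀ N n, Adapted n (F N n) := by
    intro N n π π' h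
    refine Finset.prod_congr rfl fun k hk => ?_
    have := Finset.mem_range.1 hk
    rw [h k this.le, h (k + 1) this]
  have hF0 : ∀ N n π, 0 ≤ F N n π := fun N n π => Finset.prod_nonneg fun k _ => hb0 _ _ _ _
  -- Fatou's lemma: the capital does not tend to infinity
  have hnull : ∀ N, ∀ᵐ π ∂μ, ¬ Tendsto (fun n => F N n π) atTop atTop := by
    intro N
    have hmeas : ∀ n, Measurable fun π => ENNReal.ofReal (F N n π) := fun n =>
      (hF N n).measurable.ennreal_ofReal
    have hle : ∫⁻ π, liminf (fun n => ENNReal.ofReal (F N n π)) atTop ∂μ ≤ 1 := by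
      refine (lintegral_liminf_le hmeas).trans ?_
      refine liminf_le_of_le (h := fun b hb => ?_)
      obtain ⟨n, hn⟩ := hb.exists
      refine hn.trans ?_
      rw [← ofReal_integral_eq_lintegral_ofReal ((hF N n).integrable μ) (.of_forall (hF0 N n))]
      exact ENNReal.ofReal_le_one.2 (integral_prod_bet_le δ v u w q hq N n)
    have hfin := ae_lt_top (Measurable.liminf hmeas)
      (ne_top_of_le_ne_top ENNReal.one_ne_top hle)
    filter_upwards [hfin] with π hπ ht
    have := (ENNReal.tendsto_ofReal_atTop.comp ht).liminf_eq
    simp only [Function.comp_def] at this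
    simp [this] at hπ
  filter_upwards [ae_all_iff.2 hnull] with π hπ hu
  by_contra hw'
  simp only [infSet, Set.mem_ofPred_eq, not_forall, not_exists] at hw'
  obtain ⟨N, hN⟩ := hw'
  refine hπ N ?_
  classical
  -- From time `N` on no bet is lost.
  have hb : ∀ k, bet N u w r k (π k) (π (k + 1)) = if N ≤ k ∧ π k = u then 1 + r else 1 := by
    intro k
    by_cases hc : N ≤ k ∧ π k = u
    · have : π (k + 1) ≠ w := by
        have := hN (k + 1 - N)
        rwa [Nat.add_sub_cancel' (hc.1.trans k.le_succ)] at this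
      simp [bet, hc, this]
    · simp [bet, hc]
  have hmono : Monotone fun n => F N n π := by
    refine monotone_nat_of_le_succ fun n => ?_
    simp only [F, Finset.prod_range_succ]
    refine le_mul_of_one_le_right (hF0 N n π) ?_
    rw [hb]
    split_ifs <;> linarith
  -- Each further visit to `u` contributes another factor `1 + r`.
  have hexp : ∀ m : ℕ, ∃ n, (1 + r) ^ m ≤ F N n π := by
    intro m
    induction m with
    | zero => exact ⟨0, by simp [F]⟩
    | succ m ih =>
      obtain ⟨n, hn⟩ := ih
      obtain ⟨k, hk⟩ := hu (max n N)
      refine ⟨max n N + k + 1, ?_⟩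
      have h1 : F N n π ≤ F N (max n N + k) π :=
        hmono (le_add_right (le_max_left _ _))
      have hNk : N ≤ max n N + k := le_add_right (le_max_right _ _)
      have h2 : F N (max n N + k + 1) π = F N (max n N + k) π * (1 + r) := by
        simp only [F, Finset.prod_range_succ]
        rw [hb, if_pos ⟨hNk, hk⟩]
      rw [h2, pow_succ]
      exact mul_le_mul_of_nonneg_right (hn.trans h1) (by linarith)
  refine tendsto_atTop_atTop_of_monotone hmono fun b => ?_
  obtain ⟨m, hm⟩ := pow_unbounded_of_one_lt b (by linarith : 1 < 1 + r)
  obtain ⟨n, hn⟩ := hexp m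
  exact ⟨n, hm.le.trans hn⟩

end Recurrence

/-! ### Strongly connected sets, BSCCs and the parity condition -/

section Combinatorics

variable {V : Type*}

theorem exists_ge_of_mem_infSet {π : ℕ → V} {u : V} (hu : u ∈ infSet π) (n : ℕ) :
    ∃ k ≥ n, π k = u := by
  obtain ⟨k, hk⟩ := hu n
  exact ⟨n + k, Nat.le_add_right n k, hk⟩

/-- From some time on all letters belong to `infSet π`; the segment between a late visit to `u` and
a strictly later visit to `w` is the required path. -/
theorem transGen_of_mem_infSet [Finite V] {R : V → V → Prop} {π : ℕ → V}
    (hR : ∀ n, R (π n) (π (n + 1))) {u w : V} (hu : u ∈ infSet π) (hw : w ∈ infSet π) :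
    Relation.TransGen (fun x y => R x y ∧ y ∈ infSet π) u w := by
  obtain ⟨N, hN⟩ := eventually_atTop.1 (eventually_mem_infSet π)
  obtain ⟨m, hm, rfl⟩ := exists_ge_of_mem_infSet hu N
  obtain ⟨k, hk, rfl⟩ := exists_ge_of_mem_infSet hw (m + 1)
  induction k, hk using Nat.le_induction with
  | base => exact .single ⟨hR m, hw⟩
  | succ k hk ih =>
    exact (ih (hN k (by omega))).tail ⟨hR k, hw⟩

/-- Maximum principle: a maximum on `S` propagates along the edges, hence to all of `S`. -/
theorem eq_of_forall_max_eq [Finite V] {R : V → V → Prop} {S : Set V}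
    (hS : ∀ u ∈ S, ∀ w ∈ S, Relation.TransGen (fun x y => R x y ∧ y ∈ S) u w) (f : V → ℝ)
    (hf : ∀ x ∈ S, (∀ y ∈ S, f y ≤ f x) → ∀ y ∈ S, R x y → f x ≤ f y) :
    ∀ x ∈ S, ∀ y ∈ S, f x = f y := by
  intro x hx
  obtain ⟨m, hm, hmax⟩ := Set.exists_max_image S f S.toFinite ⟨x, hx⟩
  have key : ∀ y ∈ S, f y = f m := by
    intro y hy
    have : ∀ z, Relation.TransGen (fun x y => R x y ∧ y ∈ S) m z → z ∈ S ∧ f z = f m := by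
      intro z hz
      induction hz with
      | single h => exact ⟨h.2, (hmax _ h.2).antisymm (hf m hm hmax _ h.2 h.1)⟩
      | tail _ h ih =>
        refine ⟨h.2, (hmax _ h.2).antisymm ?_⟩
        rw [← ih.2]
        exact hf _ ih.1 (fun y hy => ih.2 ▸ hmax y hy) _ h.2 h.1
    exact (this y (hS m hm y hy)).2
  intro y hy
  rw [key x hx, key y hy]

theorem mem_of_transGen {R : V → V → Prop} {S : Set V} (hS : ∀ u ∈ S, ∀ w, R u w → w ∈ S)
    {u w : V} (hu : u ∈ S) (h : Relation.TransGen R u w) : w ∈ S := by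
  induction h with
  | single h => exact hS _ hu _ h
  | tail _ h ih => exact hS _ ih _ h

theorem transGen_mem_of_transGen {R : V → V → Prop} {S : Set V}
    (hS : ∀ u ∈ S, ∀ w, R u w → w ∈ S) {u w : V} (hu : u ∈ S) (h : Relation.TransGen R u w) :
    Relation.TransGen (fun x y => R x y ∧ y ∈ S) u w := by
  induction h with
  | single h => exact .single ⟨h, hS _ hu _ h⟩
  | tail h h' ih => exact ih.tail ⟨h', hS _ (mem_of_transGen hS hu h) _ h'⟩

/-- Maximality is automatic, since no path leaves a closed set. -/
theorem isBSCC_of_closed {δ : V → PMF V} {L : Set V} (hne : L.Nonempty)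
    (hsc : StronglyConnected δ L) (hcl : ∀ u ∈ L, ∀ w ∈ (δ u).support, w ∈ L) : IsBSCC δ L where
  nonempty := hne
  stronglyConnected := hsc
  maximal L' hL' hLL' := by
    obtain ⟨u, hu⟩ := hne
    exact Set.Subset.antisymm (fun w hw => mem_of_transGen hcl hu (hL' u (hLL' hu) w hw)) hLL'
  closed := hcl

theorem _root_.IsBSCC.subset_of_closed {δ : V → PMF V} {U S : Set V} (hU : IsBSCC δ U)
    (hS : ∀ u ∈ S, ∀ w ∈ (δ u).support, w ∈ S) {x : V} (hxU : x ∈ U) (hxS : x ∈ S) : U ⊆ S :=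
  fun y hy => mem_of_transGen hS hxS (hU.stronglyConnected x hxU y hy)

theorem _root_.IsBSCC.eq_of_mem {δ : V → PMF V} {U U' : Set V} (hU : IsBSCC δ U) (hU' : IsBSCC δ U')
    {x : V} (hx : x ∈ U) (hx' : x ∈ U') : U = U' :=
  (hU.subset_of_closed hU'.closed hx hx').antisymm (hU'.subset_of_closed hU.closed hx' hx)

/-- The sequences in which the least priority that is seen infinitely often is even. -/
def evenSet (p : V → ℕ) : Set (ℕ → V) := {π | Even (sInf (p '' infSet π))}

theorem sInf_image_add_one (p : V → ℕ) {S : Set V} (hS : S.Nonempty) :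
    sInf ((fun v => p v + 1) '' S) = sInf (p '' S) + 1 := by
  refine le_antisymm ?_ ?_
  · obtain ⟨u, hu, hup⟩ := Nat.sInf_mem (hS.image p)
    rw [← hup]
    exact Nat.sInf_le ⟨u, hu, rfl⟩
  · obtain ⟨u, hu, hup⟩ := Nat.sInf_mem (hS.image fun v => p v + 1)
    rw [← hup]
    exact Nat.succ_le_succ (Nat.sInf_le ⟨u, hu, rfl⟩)

/-- Raising all priorities by one exchanges the roles of the players, so lower bounds become upper
bounds and results for Eve serve Adam. Nonemptiness of `infSet π` matters because `sInf ∅ = 0`. -/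
theorem evenSet_add_one [Finite V] (p : V → ℕ) :
    evenSet (fun v => p v + 1) = (evenSet p : Set (ℕ → V))ᶜ := by
  ext π
  change Even (sInf ((fun v => p v + 1) '' infSet π)) ↔ ¬ Even (sInf (p '' infSet π))
  rw [sInf_image_add_one p (infSet_nonempty π), Nat.even_add_one]

end Combinatorics

/-! ### Expectations over a distribution on a finite set -/

section Expectation

variable {V : Type*} [Finite V] [MeasurableSpace V] [DiscreteMeasurableSpace V]

theorem integral_toMeasure_eq_sum [Fintype V] (q : PMF V) (f : V → ℝ) :
    ∫ w, f w ∂q.toMeasure = ∑ w, (q w).toReal * f w := by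
  rw [integral_fintype .of_finite]
  simp [measureReal_def, PMF.toMeasure_apply_singleton _ _ (MeasurableSet.of_discrete)]

theorem ae_toMeasure_iff (q : PMF V) (P : V → Prop) :
    (∀ᵐ w ∂q.toMeasure, P w) ↔ ∀ w ∈ q.support, P w := by
  rw [ae_iff, PMF.toMeasure_apply_eq_zero_iff _ .of_discrete, Set.disjoint_left]
  simp

theorem integral_toMeasure_mono (q : PMF V) {f g : V → ℝ} (h : ∀ w ∈ q.support, f w ≤ g w) :
    ∫ w, f w ∂q.toMeasure ≤ ∫ w, g w ∂q.toMeasure :=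
  integral_mono_ae .of_finite .of_finite ((ae_toMeasure_iff q _).2 h)

theorem integral_toMeasure_congr (q : PMF V) {f g : V → ℝ} (h : ∀ w ∈ q.support, f w = g w) :
    ∫ w, f w ∂q.toMeasure = ∫ w, g w ∂q.toMeasure :=
  integral_congr_ae ((ae_toMeasure_iff q _).2 h)

theorem integral_toMeasure_of_eq (q : PMF V) {f : V → ℝ} {c : ℝ} (h : ∀ w ∈ q.support, f w = c) :
    ∫ w, f w ∂q.toMeasure = c := by
  rw [integral_toMeasure_congr q (g := fun _ => c) h]
  simp

theorem integral_toMeasure_pure (w : V) (f : V → ℝ) : ∫ y, f y ∂(PMF.pure w).toMeasure = f w := by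
  rw [PMF.toMeasure_pure, integral_dirac]

/-- The nonnegative function `c - f` has integral zero. This feeds the maximum principle for
subharmonic functions. -/
theorem le_of_le_integral_toMeasure (q : PMF V) {f : V → ℝ} {c : ℝ}
    (h : ∀ w ∈ q.support, f w ≤ c) (hc : c ≤ ∫ w, f w ∂q.toMeasure) :
    ∀ w ∈ q.support, c ≤ f w := by
  have h1 : ∫ w, (c - f w) ∂q.toMeasure = 0 := by
    refine le_antisymm ?_ (integral_nonneg_of_ae ((ae_toMeasure_iff q _).2 fun w hw =>
      sub_nonneg.2 (h w hw)))
    rw [integral_sub (integrable_const _) .of_finite]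
    simpa using hc
  rw [integral_eq_zero_iff_of_nonneg_ae ((ae_toMeasure_iff q _).2 fun w hw =>
      sub_nonneg.2 (h w hw)) .of_finite] at h1
  intro w hw
  have := (ae_toMeasure_iff q _).1 h1 w hw
  simp only [Pi.zero_apply] at this
  linarith

end Expectation

/-! ### Parity probabilities of Markov chains via harmonic functions -/

section Chain

variable {V : Type*} [Finite V] [MeasurableSpace V] [DiscreteMeasurableSpace V]

theorem measurableSet_evenSet (p : V → ℕ) : MeasurableSet (evenSet p) :=
  measurableSet_infSet fun S => Even (sInf (p '' S))

/-- The law of the run from `v` of the Markov chain with the transition function `δ`. -/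
noncomputable def chainMeasure (δ : V → PMF V) (v : V) : Measure (ℕ → V) :=
  policyMeasure (fun _ h => δ h.last) v

instance (δ : V → PMF V) (v : V) : IsProbabilityMeasure (chainMeasure δ v) :=
  inferInstanceAs (IsProbabilityMeasure (policyMeasure _ v))

/-- Closedness is the betting argument applied to every transition; strong connectivity is read off
the path itself. -/
theorem ae_isBSCC_infSet (δ : V → PMF V) (v : V) :
    ∀ᵐ π ∂chainMeasure δ v, IsBSCC δ (infSet π) := by
  have h1 : ∀ᵐ π ∂chainMeasure δ v, ∀ u w, w ∈ (δ u).support → u ∈ infSet π → w ∈ infSet π := by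
    refine ae_all_iff.2 fun u => ae_all_iff.2 fun w => ?_
    by_cases hw : w ∈ (δ u).support
    · filter_upwards [ae_mem_infSet_of_mem_support (fun _ h => δ h.last) v u w (δ u)
        (fun n h hh => by rw [hh]) hw] with π hπ _ using hπ
    · simp [hw]
  filter_upwards [h1, ae_policyMeasure_mem_support (fun _ h => δ h.last) v] with π hcl hsupp
  refine isBSCC_of_closed (infSet_nonempty π) (fun u hu w hw => ?_)
    fun u hu w hw => hcl u w hw hu
  exact Relation.TransGen.mono (fun _ _ h => h.1) _ _
    (transGen_of_mem_infSet (R := fun x y => y ∈ (δ x).support) hsupp hu hw)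

theorem _root_.IsBSCC.eq_of_subharmonic {δ : V → PMF V} {U : Set V} (hU : IsBSCC δ U) {f : V → ℝ}
    (hf : ∀ x ∈ U, f x ≤ ∫ w, f w ∂(δ x).toMeasure) : ∀ x ∈ U, ∀ y ∈ U, f x = f y := by
  refine eq_of_forall_max_eq (R := fun x y => y ∈ (δ x).support)
    (fun u hu w hw => transGen_mem_of_transGen hU.closed hu (hU.stronglyConnected u hu w hw)) f ?_
  intro x hx hmax y _ hxy
  exact le_of_le_integral_toMeasure (δ x) (fun w hw => hmax w (hU.closed x hx w hw)) (hf x hx) y hxy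

/-- A subharmonic function which is at most `1` on the recurrent states and at most `0` on those of
odd parity is a lower bound for the probability of the parity condition. -/
theorem le_measureReal_evenSet (δ : V → PMF V) (p : V → ℕ) (f : V → ℝ)
    (hsub : ∀ x, f x ≤ ∫ w, f w ∂(δ x).toMeasure)
    (h1 : ∀ U, IsBSCC δ U → ∀ x ∈ U, f x ≤ 1)
    (h0 : ∀ U, IsBSCC δ U → Odd (sInf (p '' U)) → ∀ x ∈ U, f x ≤ 0) (v : V) :
    f v ≤ (chainMeasure δ v).real (evenSet p) := by
  set μ := chainMeasure δ v
  let χ : (ℕ → V) → ℝ := (evenSet p).indicator 1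
  obtain ⟨C, hC⟩ : ∃ C : ℝ, ∀ x, f x ≤ C := by
    obtain ⟨C, hC⟩ := (Set.finite_range f).bddAbove
    exact ⟨C, fun x => hC ⟨x, rfl⟩⟩
  -- The bad event that `f` still exceeds the indicator of the parity condition at some time from
  -- `N` on. Almost every path ends in a BSCC, where `h1` and `h0` exclude this, so `μ (B N)` tends
  -- to 0.
  let B : ℕ → Set (ℕ → V) := fun N => {π | ∃ n ≥ N, χ π < f (π n)}
  have hχ : Measurable χ := measurable_one.indicator (measurableSet_evenSet p)
  have hBmeas : ∀ N, MeasurableSet (B N) := by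
    intro N
    have : B N = ⋃ n ≥ N, {π | χ π < f (π n)} := by
      ext π
      simp [B]
    rw [this]
    exact .iUnion fun n => .iUnion fun _ => measurableSet_lt hχ
      ((measurable_of_countable f).comp (measurable_pi_apply n))
  have hBnull : μ (⋂ N, B N) = 0 := by
    rw [← compl_compl (⋂ N, B N)]
    refine mem_ae_iff.1 ?_
    filter_upwards [ae_isBSCC_infSet δ v] with π hπ hmem
    obtain ⟨N, hN⟩ := eventually_atTop.1 (eventually_mem_infSet π)
    obtain ⟨n, hn, hlt⟩ := Set.mem_iInter.1 hmem N
    refine absurd hlt (not_lt.2 ?_)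
    by_cases he : π ∈ evenSet p
    · simpa [χ, he] using h1 _ hπ _ (hN n hn)
    · simpa [χ, he] using h0 _ hπ (Nat.not_even_iff_odd.1 he) _ (hN n hn)
  have hlim : Tendsto (fun N => μ.real (evenSet p) + max C 0 * μ.real (B N)) atTop
      (𝓝 (μ.real (evenSet p) + max C 0 * 0)) := by
    refine tendsto_const_nhds.add (tendsto_const_nhds.mul ?_)
    have := tendsto_measure_iInter_atTop (μ := μ) (fun N => (hBmeas N).nullMeasurableSet)
      (fun N M hNM π ⟨n, hn, h⟩ => ⟨n, hNM.trans hn, h⟩) ⟨0, measure_ne_top _ _⟩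
    rw [hBnull] at this
    exact (ENNReal.tendsto_toReal ENNReal.zero_ne_top).comp this
  rw [mul_zero, add_zero] at hlim
  -- By subharmonicity `f v` is at most the mean of `f (π N)`, which is bounded by the indicator off
  -- `B N` and by `C` on it.
  refine ge_of_tendsto' hlim fun N => ?_
  have hstep := le_integral_stoppedAt (fun _ h => δ h.last) ∅ (fun _ => f) (fun _ _ _ => le_rfl)
    (fun n h _ => hsub h.last) v N
  simp only [stoppedAt_empty] at hstep
  refine hstep.trans ?_
  have had : Adapted N fun π : ℕ → V => f (π N) := fun π π' h => by simp only [h N le_rfl]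
  have hiχ : Integrable χ μ := (integrable_const 1).indicator (measurableSet_evenSet p)
  have hiB : Integrable ((B N).indicator fun _ => max C 0) μ :=
    (integrable_const _).indicator (hBmeas N)
  calc ∫ π, f (π N) ∂μ ≤ ∫ π, (χ π + (B N).indicator (fun _ => max C 0) π) ∂μ := by
        refine integral_mono (had.integrable _) (hiχ.add hiB) fun π => ?_
        have hχ0 : 0 ≤ χ π := Set.indicator_nonneg (fun _ _ => zero_le_one) _
        by_cases hπ : π ∈ B N
        · simp only [hπ, Set.indicator_of_mem]
          exact (hC _).trans ((le_max_left _ _).trans (le_add_of_nonneg_left hχ0))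
        · simp only [hπ, not_false_eq_true, Set.indicator_of_notMem, add_zero]
          by_contra hlt
          exact hπ ⟨N, le_rfl, not_le.1 hlt⟩
    _ = _ := by
        rw [integral_add hiχ hiB, integral_indicator_one (measurableSet_evenSet p),
          integral_indicator_const _ (hBmeas N), smul_eq_mul, mul_comm]

theorem measureReal_evenSet_add_one (μ : Measure (ℕ → V)) [IsProbabilityMeasure μ] (p : V → ℕ) :
    μ.real (evenSet fun v => p v + 1) = 1 - μ.real (evenSet p) := by
  rw [evenSet_add_one, probReal_compl_eq_one_sub (measurableSet_evenSet p)]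

/-- A harmonic function which is `1` on the even and `0` on the odd recurrent classes is the
probability of the parity condition. -/
theorem eq_measureReal_evenSet (δ : V → PMF V) (p : V → ℕ) (f : V → ℝ)
    (hf : ∀ x, f x = ∫ w, f w ∂(δ x).toMeasure)
    (h1 : ∀ U, IsBSCC δ U → Even (sInf (p '' U)) → ∀ x ∈ U, f x = 1)
    (h0 : ∀ U, IsBSCC δ U → Odd (sInf (p '' U)) → ∀ x ∈ U, f x = 0) (v : V) :
    (chainMeasure δ v).real (evenSet p) = f v := by
  refine le_antisymm ?_ ?_
  -- The upper bound is the lower bound for `1 - f` and the complementary objective.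
  · have h := le_measureReal_evenSet δ (fun v => p v + 1) (fun x => 1 - f x) (fun x => ?_)
      (fun U hU x hx => ?_) (fun U hU ho x hx => ?_) v
    · rw [measureReal_evenSet_add_one] at h
      linarith
    · rw [integral_sub (integrable_const _) .of_finite, ← hf x]
      simp
    · rcases Nat.even_or_odd (sInf (p '' U)) with h | h
      · simp [h1 U hU h x hx]
      · simp [h0 U hU h x hx]
    · rw [sInf_image_add_one p hU.nonempty, Nat.odd_add_one, Nat.not_odd_iff_even] at ho
      simp [h1 U hU ho x hx]
  · refine le_measureReal_evenSet δ p f (fun x => (hf x).le) (fun U hU x hx => ?_)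
      (fun U hU ho x hx => (h0 U hU ho x hx).le) v
    rcases Nat.even_or_odd (sInf (p '' U)) with h | h
    · rw [h1 U hU h x hx]
    · rw [h0 U hU h x hx]
      exact zero_le_one

end Chain

/-! ### The linear system for parity probabilities and its denominators -/

section LinearSystem

open Matrix

variable {V : Type*} [Finite V] [MeasurableSpace V] [DiscreteMeasurableSpace V]

/-- The recurrent states of a Markov chain. -/
def recurrent (δ : V → PMF V) : Set V := {u | ∃ U, IsBSCC δ U ∧ u ∈ U}

/-- The union of the recurrent classes of even parity. -/
def evenRecurrent (δ : V → PMF V) (p : V → ℕ) : Set V :=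
  {u | ∃ U, IsBSCC δ U ∧ Even (sInf (p '' U)) ∧ u ∈ U}

open Classical in
/-- The matrix of the linear system for the probability of a parity condition. -/
noncomputable def chainMatrix (δ : V → PMF V) : Matrix V V ℝ :=
  Matrix.of fun u w => (if u = w then 1 else 0) - if u ∈ recurrent δ then 0 else (δ u w).toReal

open Classical in
theorem chainMatrix_mulVec [Fintype V] (δ : V → PMF V) (x : V → ℝ) (u : V) :
    (chainMatrix δ *ᵥ x) u =
      x u - if u ∈ recurrent δ then 0 else ∫ w, x w ∂(δ u).toMeasure := by
  rw [integral_toMeasure_eq_sum]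
  simp only [chainMatrix, mulVec, dotProduct, of_apply, sub_mul, Finset.sum_sub_distrib, ite_mul,
    one_mul, zero_mul, Finset.sum_ite_eq, Finset.mem_univ, if_true]
  split_ifs <;> simp

/-- The system expresses harmonicity at transient states only; at recurrent ones harmonicity comes
from constancy on the closed class. -/
theorem harmonic_of_chainMatrix_mulVec [Fintype V] (δ : V → PMF V) (x : V → ℝ)
    (hx : ∀ u ∉ recurrent δ, (chainMatrix δ *ᵥ x) u = 0)
    (hU : ∀ U, IsBSCC δ U → ∀ u ∈ U, ∀ w ∈ U, x w = x u) (u : V) :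
    x u = ∫ w, x w ∂(δ u).toMeasure := by
  by_cases hu : u ∈ recurrent δ
  · obtain ⟨U, hU', hu⟩ := hu
    exact (integral_toMeasure_of_eq _ fun w hw => hU U hU' u hu w (hU'.closed u hu w hw)).symm
  · have := hx u hu
    rw [chainMatrix_mulVec, if_neg hu] at this
    linarith

open Classical in
-- A kernel vector `y` is harmonic and vanishes on recurrent states. For the constant priority 1
-- every class is odd, so both `y` and `-y` give the probability of the parity condition; hence `y =
-- -y`.
theorem det_chainMatrix_ne_zero [Fintype V] (δ : V → PMF V) : (chainMatrix δ).det ≠ 0 := by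
  rw [Ne, ← exists_mulVec_eq_zero_iff]
  rintro ⟨y, hy0, hy⟩
  have hrec : ∀ u ∈ recurrent δ, y u = 0 := by
    intro u hu
    have := congrFun hy u
    rwa [chainMatrix_mulVec, if_pos hu, sub_zero] at this
  have hU : ∀ U, IsBSCC δ U → ∀ u ∈ U, y u = 0 := fun U hU u hu => hrec u ⟨U, hU, hu⟩
  have hodd : ∀ U, IsBSCC δ U → ¬ Even (sInf ((fun _ : V => 1) '' U)) := by
    intro U hU
    rw [hU.nonempty.image_const, csInf_singleton]
    exact Nat.not_even_one
  have hharm := harmonic_of_chainMatrix_mulVec δ y (fun u _ => congrFun hy u)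
    fun U hU' u hu w hw => by rw [hU U hU' u hu, hU U hU' w hw]
  refine hy0 (funext fun v => ?_)
  have h1 := eq_measureReal_evenSet δ (fun _ => 1) y hharm
    (fun U hU' he => absurd he (hodd U hU')) (fun U hU' _ => hU U hU') v
  have h2 := eq_measureReal_evenSet δ (fun _ => 1) (fun x => -y x)
    (fun u => by rw [integral_neg, ← hharm u])
    (fun U hU' he => absurd he (hodd U hU'))
    (fun U hU' _ u hu => by rw [hU U hU' u hu, neg_zero]) v
  simp only [Pi.zero_apply]
  linarith

/-- The probability of the parity condition in a Markov chain. -/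
noncomputable def parityVal (δ : V → PMF V) (p : V → ℕ) (v : V) : ℝ :=
  (chainMeasure δ v).real (evenSet p)

open Classical in
-- The solution of the system is harmonic with the right values on the classes, so it is the parity
-- probability by `eq_measureReal_evenSet`. Harmonicity of `parityVal` is deduced from this, without
-- shifting paths in time.
theorem chainMatrix_mulVec_parityVal [Fintype V] (δ : V → PMF V) (p : V → ℕ) :
    chainMatrix δ *ᵥ parityVal δ p = (evenRecurrent δ p).indicator 1 := by
  set b : V → ℝ := (evenRecurrent δ p).indicator 1 with hb
  set x := (chainMatrix δ)⁻¹ *ᵥ b with hx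
  have hAx : chainMatrix δ *ᵥ x = b := by
    rw [hx, mulVec_mulVec, mul_nonsing_inv _ (det_chainMatrix_ne_zero δ).isUnit, one_mulVec]
  have hrec : ∀ u ∈ recurrent δ, x u = b u := by
    intro u hu
    have := congrFun hAx u
    rwa [chainMatrix_mulVec, if_pos hu, sub_zero] at this
  have heven : ∀ U, IsBSCC δ U → Even (sInf (p '' U)) → ∀ u ∈ U, x u = 1 := by
    intro U hU he u hu
    rw [hrec u ⟨U, hU, hu⟩, hb, Set.indicator_of_mem (show u ∈ evenRecurrent δ p from
      ⟨U, hU, he, hu⟩), Pi.one_apply]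
  have hodd : ∀ U, IsBSCC δ U → Odd (sInf (p '' U)) → ∀ u ∈ U, x u = 0 := by
    intro U hU ho u hu
    rw [hrec u ⟨U, hU, hu⟩, hb, Set.indicator_of_notMem]
    rintro ⟨U', hU', he, hu'⟩
    rw [hU'.eq_of_mem hU hu' hu, ← Nat.not_odd_iff_even] at he
    exact he ho
  have hharm := harmonic_of_chainMatrix_mulVec δ x
    (fun u hu => by
      rw [hAx, hb, Set.indicator_of_notMem]
      exact fun ⟨U, hU, _, h⟩ => hu ⟨U, hU, h⟩)
    (fun U hU u hu w hw => by
      rcases Nat.even_or_odd (sInf (p '' U)) with h | h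
      · rw [heven U hU h u hu, heven U hU h w hw]
      · rw [hodd U hU h u hu, hodd U hU h w hw])
  have : parityVal δ p = x := funext (eq_measureReal_evenSet δ p x hharm heven hodd)
  rw [this, hAx]

theorem parityVal_of_mem_recurrent (δ : V → PMF V) (p : V → ℕ) {u : V} (hu : u ∈ recurrent δ) :
    parityVal δ p u = (evenRecurrent δ p).indicator 1 u := by
  classical
  have := Fintype.ofFinite V
  have := congrFun (chainMatrix_mulVec_parityVal δ p) u
  rwa [chainMatrix_mulVec, if_pos hu, sub_zero] at this

theorem parityVal_of_even {δ : V → PMF V} {p : V → ℕ} {U : Set V} (hU : IsBSCC δ U)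
    (he : Even (sInf (p '' U))) {u : V} (hu : u ∈ U) : parityVal δ p u = 1 := by
  rw [parityVal_of_mem_recurrent δ p ⟨U, hU, hu⟩, Set.indicator_of_mem (show u ∈ evenRecurrent δ p
    from ⟨U, hU, he, hu⟩), Pi.one_apply]

theorem parityVal_of_odd {δ : V → PMF V} {p : V → ℕ} {U : Set V} (hU : IsBSCC δ U)
    (ho : Odd (sInf (p '' U))) {u : V} (hu : u ∈ U) : parityVal δ p u = 0 := by
  rw [parityVal_of_mem_recurrent δ p ⟨U, hU, hu⟩, Set.indicator_of_notMem]
  rintro ⟨U', hU', he, hu'⟩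
  rw [hU'.eq_of_mem hU hu' hu, ← Nat.not_odd_iff_even] at he
  exact he ho

theorem parityVal_harmonic (δ : V → PMF V) (p : V → ℕ) (u : V) :
    parityVal δ p u = ∫ w, parityVal δ p w ∂(δ u).toMeasure := by
  classical
  have := Fintype.ofFinite V
  refine harmonic_of_chainMatrix_mulVec δ _ (fun u hu => ?_) (fun U hU u hu w hw => ?_) u
  · rw [chainMatrix_mulVec_parityVal, Set.indicator_of_notMem]
    exact fun ⟨U, hU, _, h⟩ => hu ⟨U, hU, h⟩
  · rcases Nat.even_or_odd (sInf (p '' U)) with h | h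
    · rw [parityVal_of_even hU h hu, parityVal_of_even hU h hw]
    · rw [parityVal_of_odd hU h hu, parityVal_of_odd hU h hw]

theorem parityVal_nonneg (δ : V → PMF V) (p : V → ℕ) (u : V) : 0 ≤ parityVal δ p u :=
  measureReal_nonneg

theorem parityVal_le_one (δ : V → PMF V) (p : V → ℕ) (u : V) : parityVal δ p u ≤ 1 :=
  measureReal_le_one

/-- If the rows of the transition matrix have the denominators `D u ≤ K`, then the probabilities of
a parity condition have a common denominator that is at most `n! K ^ n`. -/
theorem exists_denominator_parityVal [Fintype V] (δ : V → PMF V) (p : V → ℕ) (D : V → ℕ)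
    (N : V → V → ℕ) (K : ℕ) (hD : ∀ u, 0 < D u) (hK : ∀ u, D u ≤ K)
    (hN : ∀ u w, (D u : ℝ) * (δ u w).toReal = N u w) :
    ∃ d : ℕ, 0 < d ∧ d ≤ (Fintype.card V).factorial * K ^ Fintype.card V ∧
      ∀ v, ∃ z : ℤ, parityVal δ p v * d = z := by
  classical
  -- Clear denominators: row `u` of `chainMatrix δ` times `D u`.
  let B : Matrix V V ℤ := Matrix.of fun u w =>
    (if u = w then (D u : ℤ) else 0) - if u ∈ recurrent δ then 0 else (N u w : ℤ)
  let r : V → ℤ := (evenRecurrent δ p).indicator fun u => (D u : ℤ)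
  have hBA : ∀ u w, ((B u w : ℤ) : ℝ) = D u * chainMatrix δ u w := by
    intro u w
    simp only [B, chainMatrix, of_apply]
    push_cast
    rw [mul_sub, mul_ite, mul_ite, hN]
    simp
  have hle : ∀ u w, |chainMatrix δ u w| ≤ 1 := by
    intro u w
    have h0 : 0 ≤ (δ u w).toReal := ENNReal.toReal_nonneg
    have h1 : (δ u w).toReal ≤ 1 := by
      simpa using ENNReal.toReal_mono ENNReal.one_ne_top ((δ u).coe_le_one w)
    simp only [chainMatrix, of_apply, abs_le]
    split_ifs <;> constructor <;> linarith
  have hBle : ∀ u w, AbsoluteValue.abs (B u w) ≤ (K : ℤ) := by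
    intro u w
    have : |((B u w : ℤ) : ℝ)| ≤ K := by
      rw [hBA, abs_mul, abs_of_nonneg (Nat.cast_nonneg _)]
      calc (D u : ℝ) * |chainMatrix δ u w| ≤ D u * 1 :=
            mul_le_mul_of_nonneg_left (hle u w) (Nat.cast_nonneg _)
        _ ≤ K := by
            rw [mul_one]
            exact_mod_cast hK u
    exact_mod_cast this
  have hBmap : B.map ((↑) : ℤ → ℝ) = Matrix.diagonal (fun u => (D u : ℝ)) * chainMatrix δ := by
    ext u w
    rw [diagonal_mul, map_apply, hBA]
  have hdet : ((B.det : ℤ) : ℝ) = (∏ u, (D u : ℝ)) * (chainMatrix δ).det := by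
    rw [← det_diagonal, ← det_mul, ← hBmap]
    exact (Int.castRingHom ℝ).map_det B
  have hdet0 : B.det ≠ 0 := by
    intro h
    rw [h, Int.cast_zero] at hdet
    rcases mul_eq_zero.1 hdet.symm with h | h
    · obtain ⟨u, _, hu⟩ := Finset.prod_eq_zero_iff.1 h
      exact (hD u).ne' (by exact_mod_cast hu)
    · exact det_chainMatrix_ne_zero δ h
  have hr : (B.map ((↑) : ℤ → ℝ)) *ᵥ parityVal δ p = fun u => (r u : ℝ) := by
    rw [hBmap, ← mulVec_mulVec, chainMatrix_mulVec_parityVal]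
    funext u
    rw [mulVec_diagonal]
    by_cases hu : u ∈ evenRecurrent δ p <;> simp [r, hu]
  -- Cramer's rule, by multiplying with the integral adjugate.
  have hsol : ∀ v, (B.det : ℝ) * parityVal δ p v = ((B.adjugate *ᵥ r) v : ℤ) := by
    intro v
    have h := congrArg (fun y => (B.map ((↑) : ℤ → ℝ)).adjugate *ᵥ y) hr
    simp only [mulVec_mulVec, adjugate_mul] at h
    have h' := congrFun h v
    rw [smul_mulVec, one_mulVec, Pi.smul_apply, smul_eq_mul] at h'
    have e1 : (B.map ((↑) : ℤ → ℝ)).det = (B.det : ℝ) := ((Int.castRingHom ℝ).map_det B).symm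
    have e2 : (B.map ((↑) : ℤ → ℝ)).adjugate = B.adjugate.map ((↑) : ℤ → ℝ) :=
      ((Int.castRingHom ℝ).map_adjugate B).symm
    rw [← e1, h', e2]
    simp [mulVec, dotProduct]
  -- The common denominator is `|det B|`; the Leibniz formula bounds it, as all entries of `B` have
  -- modulus at most `K`.
  refine ⟨B.det.natAbs, Int.natAbs_pos.2 hdet0, ?_, fun v => ?_⟩
  · have := det_le (A := B) (abv := AbsoluteValue.abs) hBle
    rw [nsmul_eq_mul] at this
    zify
    exact_mod_cast this
  · rcases Int.natAbs_eq B.det with h | h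
    · refine ⟨(B.adjugate *ᵥ r) v, ?_⟩
      rw [← hsol v, mul_comm, ← Int.cast_natCast, ← h]
    · refine ⟨-(B.adjugate *ᵥ r) v, ?_⟩
      have h' : ((B.det.natAbs : ℕ) : ℤ) = -B.det := by omega
      rw [Int.cast_neg, ← hsol v, mul_comm, ← Int.cast_natCast, h', Int.cast_neg, neg_mul]

/-- The positive number `(y - x) d e` is an integer, hence at least 1, and `d e ≤ L²`. -/
theorem one_div_sq_le_sub {x y : ℝ} {d e L : ℕ} {z t : ℤ} (hd : 0 < d) (he : 0 < e) (hdL : d ≤ L)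
    (heL : e ≤ L) (hx : x * d = z) (hy : y * e = t) (hxy : x < y) : 1 / (L : ℝ) ^ 2 ≤ y - x := by
  have hd' : (0 : ℝ) < d := by exact_mod_cast hd
  have he' : (0 : ℝ) < e := by exact_mod_cast he
  have hdL' : (d : ℝ) ≤ L := by exact_mod_cast hdL
  have heL' : (e : ℝ) ≤ L := by exact_mod_cast heL
  have h1 : (y - x) * (d * e) = ((t * d - z * e : ℤ) : ℝ) := by
    push_cast
    rw [← hx, ← hy]
    ring
  have h2 : 1 ≤ (y - x) * (d * e) := by
    have : 0 < (y - x) * (d * e) := mul_pos (sub_pos.2 hxy) (mul_pos hd' he')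
    rw [h1] at this ⊢
    exact_mod_cast this
  have hL : (0 : ℝ) < L := hd'.trans_le hdL'
  rw [div_le_iff₀ (by positivity)]
  refine h2.trans (mul_le_mul_of_nonneg_left ?_ (sub_pos.2 hxy).le)
  rw [sq]
  exact mul_le_mul hdL' heL' he'.le hL.le

end LinearSystem

/-! ### Distance to a target, and locality of BSCCs -/

section Rank

variable {V : Type*}

/-- The rank is the length of a shortest path to `m` whose later vertices lie in `S`; the first edge
of such a path lowers it. -/
theorem exists_rank {R : V → V → Prop} {S : Set V} {m : V}
    (h : ∀ u ∈ S, Relation.TransGen (fun x y => R x y ∧ y ∈ S) u m) :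
    ∃ rank : V → ℕ, ∀ u ∈ S, u ≠ m → ∃ w ∈ S, R u w ∧ rank w < rank u := by
  let D : ℕ → Set V := fun n => Nat.rec {m} (fun _ D => {u | ∃ w ∈ D, R u w ∧ w ∈ S}) n
  have hD : ∀ u ∈ S, ∃ n, u ∈ D n := by
    intro u hu
    have := h u hu
    clear hu
    induction this using Relation.TransGen.head_induction_on with
    | single h => exact ⟨1, m, rfl, h⟩
    | head h _ ih =>
      obtain ⟨n, hn⟩ := ih
      exact ⟨n + 1, _, hn, h⟩
  refine ⟨fun u => sInf {n | u ∈ D n}, fun u hu hum => ?_⟩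
  have hmem : u ∈ D (sInf {n | u ∈ D n}) := Nat.sInf_mem (s := {n | u ∈ D n}) (hD u hu)
  rcases hk : sInf {n | u ∈ D n} with _ | k
  · rw [hk] at hmem
    exact absurd hmem hum
  · rw [hk] at hmem
    obtain ⟨w, hw, hR, hwS⟩ := hmem
    exact ⟨w, hwS, hR, (Nat.sInf_le (s := {n | w ∈ D n}) hw).trans_lt (by
      simp only [hk]
      exact k.lt_succ_self)⟩

theorem _root_.IsBSCC.congr {δ δ' : V → PMF V} {U : Set V} (hU : IsBSCC δ U)
    (h : ∀ u ∈ U, δ' u = δ u) : IsBSCC δ' U := by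
  refine isBSCC_of_closed hU.nonempty (fun u hu w hw => ?_)
    fun u hu w hw => hU.closed u hu w (h u hu ▸ hw)
  have : ∀ z, Relation.TransGen (fun x y => y ∈ (δ x).support) u z →
      Relation.TransGen (fun x y => y ∈ (δ' x).support) u z := by
    intro z hz
    induction hz with
    | single hz => exact .single (by rwa [h u hu])
    | tail hz hz' ih =>
      exact ih.tail (by rwa [h _ (mem_of_transGen hU.closed hu hz)])
  exact this w (hU.stronglyConnected u hu w hw)

end Rank

/-! ### Pure memoryless optimal policies in parity decision processes -/

section MDP

variable {V : Type*}

/-- The Markov chain that results from the pure memoryless policy `s` in a Markov decision process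
with the controlled states `ctrl` and the transition function `δ₀` on the other states. -/
noncomputable def pureChain (ctrl : Set V) (δ₀ : V → PMF V) (s : V → V) (u : V) : PMF V :=
  open Classical in if u ∈ ctrl then PMF.pure (s u) else δ₀ u

/-- The possible moves of a Markov decision process. -/
def mdpEdge (ctrl : Set V) (E : V → V → Prop) (δ₀ : V → PMF V) (u w : V) : Prop :=
  (u ∈ ctrl → E u w) ∧ (u ∉ ctrl → w ∈ (δ₀ u).support)

/-- The policies of a Markov decision process. -/
structure IsPolicy (ctrl : Set V) (E : V → V → Prop) (δ₀ : V → PMF V)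
    (κ : ∀ n, History V n → PMF V) : Prop where
  edge : ∀ n (h : History V n), h.last ∈ ctrl → ∀ w ∈ (κ n h).support, E h.last w
  eq : ∀ n (h : History V n), h.last ∉ ctrl → κ n h = δ₀ h.last

theorem pureChain_of_mem {ctrl : Set V} {δ₀ : V → PMF V} {s : V → V} {u : V} (h : u ∈ ctrl) :
    pureChain ctrl δ₀ s u = PMF.pure (s u) := if_pos h

theorem pureChain_of_notMem {ctrl : Set V} {δ₀ : V → PMF V} {s : V → V} {u : V} (h : u ∉ ctrl) :
    pureChain ctrl δ₀ s u = δ₀ u := if_neg h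

theorem pureChain_congr {ctrl : Set V} {δ₀ : V → PMF V} {s s' : V → V} {u : V} (h : s u = s' u) :
    pureChain ctrl δ₀ s u = pureChain ctrl δ₀ s' u := by
  simp [pureChain, h]

variable [Finite V] [MeasurableSpace V] [DiscreteMeasurableSpace V]

/-- Switching to a better successor improves a pure memoryless policy. -/
theorem exists_parityVal_lt_of_edge (ctrl : Set V) (E : V → V → Prop) (δ₀ : V → PMF V)
    (p : V → ℕ) (s : V → V) (hs : ∀ u ∈ ctrl, E u (s u)) {u w : V} (hu : u ∈ ctrl) (hE : E u w)
    (hlt : parityVal (pureChain ctrl δ₀ s) p u < parityVal (pureChain ctrl δ₀ s) p w) :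
    ∃ s' : V → V, (∀ u ∈ ctrl, E u (s' u)) ∧
      (∀ x, parityVal (pureChain ctrl δ₀ s) p x ≤ parityVal (pureChain ctrl δ₀ s') p x) ∧
      parityVal (pureChain ctrl δ₀ s) p u < parityVal (pureChain ctrl δ₀ s') p u := by
  classical
  set f := parityVal (pureChain ctrl δ₀ s) p with hf
  let s' := Function.update s u w
  have hs'u : s' u = w := Function.update_self u w s
  have hs'x : ∀ x, x ≠ u → s' x = s x := fun x hx => Function.update_of_ne hx w s
  have hchain : ∀ x, x ≠ u → pureChain ctrl δ₀ s x = pureChain ctrl δ₀ s' x :=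
    fun x hx => pureChain_congr (hs'x x hx).symm
  have hchainu : pureChain ctrl δ₀ s' u = PMF.pure w := by rw [pureChain_of_mem hu, hs'u]
  -- The old value is subharmonic for the new chain, so it bounds the new value from below once it
  -- is nonpositive on the new odd classes.
  have hsub : ∀ x, f x ≤ ∫ y, f y ∂(pureChain ctrl δ₀ s' x).toMeasure := by
    intro x
    by_cases hx : x = u
    · subst hx
      rw [hchainu, integral_toMeasure_pure]
      exact hlt.le
    · rw [← hchain x hx]
      exact (parityVal_harmonic _ p x).le
  have hle : ∀ x, f x ≤ parityVal (pureChain ctrl δ₀ s') p x := by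
    refine le_measureReal_evenSet _ p f hsub (fun _ _ x _ => parityVal_le_one _ p x) ?_
    intro U hU ho x hx
    -- A class containing `u` also contains `w`, and `f` is constant on it, contrary to `hlt`. So an
    -- odd class avoids `u` and was already one of the old chain.
    have huU : u ∉ U := by
      intro huU
      have hwU : w ∈ U := hU.closed u huU w (by simp [hchainu])
      exact hlt.ne (hU.eq_of_subharmonic (fun x _ => hsub x) u huU w hwU)
    have hU' : IsBSCC (pureChain ctrl δ₀ s) U :=
      hU.congr fun y hy => hchain y fun h => huU (h ▸ hy)
    exact (parityVal_of_odd hU' ho hx).le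
  refine ⟨s', fun x hx => ?_, hle, ?_⟩
  · by_cases hxu : x = u
    · rw [hxu, hs'u]
      exact hE
    · rw [hs'x x hxu]
      exact hs x hx
  · rw [parityVal_harmonic _ p u, hchainu, integral_toMeasure_pure]
    exact hlt.trans_le (hle w)

/-- In an end component of even parity, a pure memoryless policy can be made winning. -/
theorem exists_parityVal_eq_one (ctrl : Set V) (E : V → V → Prop) (δ₀ : V → PMF V)
    (p : V → ℕ) (s : V → V) (hs : ∀ u ∈ ctrl, E u (s u)) {S : Set V} (hne : S.Nonempty)
    (hcl : ∀ u ∈ S, u ∉ ctrl → ∀ w ∈ (δ₀ u).support, w ∈ S)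
    (hsc : ∀ u ∈ S, ∀ w ∈ S,
      Relation.TransGen (fun x y => mdpEdge ctrl E δ₀ x y ∧ y ∈ S) u w)
    (heven : Even (sInf (p '' S))) :
    ∃ s' : V → V, (∀ u ∈ ctrl, E u (s' u)) ∧
      (∀ x, parityVal (pureChain ctrl δ₀ s) p x ≤ parityVal (pureChain ctrl δ₀ s') p x) ∧
      ∀ x ∈ S, parityVal (pureChain ctrl δ₀ s') p x = 1 := by
  classical
  set f := parityVal (pureChain ctrl δ₀ s) p with hf
  obtain ⟨m, hm, hpm⟩ := Nat.sInf_mem (hne.image p)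
  obtain ⟨rank, hrank⟩ := exists_rank fun u hu => hsc u hu m hm
  -- Inside `S`, move closer to a state `m` of least priority; at `m` itself, any move that stays in
  -- `S` will do.
  have hmove : ∀ u, ∃ w, u ∈ S → w ∈ S ∧ mdpEdge ctrl E δ₀ u w ∧ (u ≠ m → rank w < rank u) := by
    intro u
    by_cases hu : u ∈ S
    · by_cases hum : u = m
      · obtain ⟨w, hw, -⟩ := Relation.TransGen.head'_iff.1 (hsc u hu m hm)
        exact ⟨w, fun _ => ⟨hw.2, hw.1, fun h => absurd hum h⟩⟩
      · obtain ⟨w, hwS, hR, hlt⟩ := hrank u hu hum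
        exact ⟨w, fun _ => ⟨hwS, hR, fun _ => hlt⟩⟩
    · exact ⟨u, fun h => absurd h hu⟩
  choose t ht using hmove
  let s' : V → V := fun u => if u ∈ S then t u else s u
  have hchain : ∀ x ∉ S, pureChain ctrl δ₀ s x = pureChain ctrl δ₀ s' x := fun x hx =>
    pureChain_congr (by simp [s', hx])
  have hclosed : ∀ u ∈ S, ∀ w ∈ (pureChain ctrl δ₀ s' u).support, w ∈ S := by
    intro u hu w hw
    by_cases huc : u ∈ ctrl
    · rw [pureChain_of_mem huc, PMF.support_pure, Set.mem_singleton_iff] at hw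
      rw [hw]
      simpa [s', hu] using (ht u hu).1
    · rw [pureChain_of_notMem huc] at hw
      exact hcl u hu huc w hw
  -- A state of least rank in the class must be `m`, for any other state has a successor of smaller
  -- rank. So every class inside `S` has the even minimum of `S`.
  have hmU : ∀ U, IsBSCC (pureChain ctrl δ₀ s') U → U ⊆ S → m ∈ U := by
    intro U hU hUS
    obtain ⟨u, hu, hmin⟩ := Set.exists_min_image U rank U.toFinite hU.nonempty
    by_cases hum : u = m
    · exact hum ▸ hu
    · exfalso
      obtain ⟨w, hw, hlt⟩ : ∃ w ∈ (pureChain ctrl δ₀ s' u).support, rank w < rank u := by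
        by_cases huc : u ∈ ctrl
        · refine ⟨t u, ?_, (ht u (hUS hu)).2.2 hum⟩
          rw [pureChain_of_mem huc]
          simp [s', hUS hu]
        · refine ⟨t u, ?_, (ht u (hUS hu)).2.2 hum⟩
          rw [pureChain_of_notMem huc]
          exact (ht u (hUS hu)).2.1.2 huc
      exact absurd (hmin w (hU.closed u hu w hw)) (not_le.2 hlt)
  -- The old value raised to 1 on `S` serves as the subharmonic test function.
  let f' : V → ℝ := fun x => if x ∈ S then 1 else f x
  have hff' : ∀ x, f x ≤ f' x := by
    intro x
    by_cases hx : x ∈ S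
    · simpa [f', hx] using parityVal_le_one _ p x
    · simp [f', hx]
  have hle : ∀ x, f' x ≤ parityVal (pureChain ctrl δ₀ s') p x := by
    refine le_measureReal_evenSet _ p f' (fun x => ?_) (fun _ _ x _ => ?_) ?_
    · by_cases hx : x ∈ S
      · rw [integral_toMeasure_of_eq (c := 1) _ fun w hw => by simp [f', hclosed x hx w hw]]
        simp [f', hx]
      · rw [← hchain x hx]
        simp only [f', hx, if_false]
        rw [hf, parityVal_harmonic, ← hf]
        exact integral_toMeasure_mono _ fun w _ => hff' w
    · by_cases hx : x ∈ S
      · simp [f', hx]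
      · simpa [f', hx] using parityVal_le_one _ p x
    · intro U hU ho x hx
      by_cases hUS : (U ∩ S).Nonempty
      · exfalso
        obtain ⟨y, hyU, hyS⟩ := hUS
        have hsub : U ⊆ S := hU.subset_of_closed hclosed hyU hyS
        have : sInf (p '' U) = sInf (p '' S) := by
          refine le_antisymm ?_ ?_
          · rw [← hpm]
            exact Nat.sInf_le ⟨m, hmU U hU hsub, rfl⟩
          · obtain ⟨z, hz, hpz⟩ := Nat.sInf_mem (hU.nonempty.image p)
            rw [← hpz]
            exact Nat.sInf_le ⟨z, hsub hz, rfl⟩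
        rw [this] at ho
        exact Nat.not_even_iff_odd.2 ho heven
      · have hdis : ∀ y ∈ U, y ∉ S := fun y hy hyS => hUS ⟨y, hy, hyS⟩
        have hU' : IsBSCC (pureChain ctrl δ₀ s) U := hU.congr fun y hy => hchain y (hdis y hy)
        simp only [f', hdis x hx, if_false]
        exact (parityVal_of_odd hU' ho hx).le
  refine ⟨s', fun u hu => ?_, fun x => (hff' x).trans (hle x), fun x hx => ?_⟩
  · by_cases huS : u ∈ S
    · simpa [s', huS] using (ht u huS).2.1.1 hu
    · simpa [s', huS] using hs u hu
  · refine (parityVal_le_one _ p x).antisymm ?_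
    simpa [f', hx] using hle x

/-- Markov decision processes with a parity objective have optimal policies that are pure and
memoryless. -/
theorem exists_optimal_pureChain (ctrl : Set V) (E : V → V → Prop) (δ₀ : V → PMF V)
    (p : V → ℕ) (hE : ∀ u ∈ ctrl, ∃ w, E u w) :
    ∃ s : V → V, (∀ u ∈ ctrl, E u (s u)) ∧ ∀ κ, IsPolicy ctrl E δ₀ κ → ∀ v,
      (policyMeasure κ v).real (evenSet p) ≤ parityVal (pureChain ctrl δ₀ s) p v := by
  classical
  have := Fintype.ofFinite V
  have hne : {s : V → V | ∀ u ∈ ctrl, E u (s u)}.Nonempty := by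
    have : ∀ u, ∃ w, u ∈ ctrl → E u w := fun u => by
      by_cases hu : u ∈ ctrl
      · obtain ⟨w, hw⟩ := hE u hu
        exact ⟨w, fun _ => hw⟩
      · exact ⟨u, fun h => absurd h hu⟩
    choose s hs using this
    exact ⟨s, hs⟩
  -- Maximizing the sum of the values excludes policies that improve some state without harming
  -- another.
  obtain ⟨s, hs, hmax⟩ := Set.exists_max_image _
    (fun s => ∑ v, parityVal (pureChain ctrl δ₀ s) p v) (Set.toFinite _) hne
  refine ⟨s, hs, fun κ hκ v => ?_⟩
  set f := parityVal (pureChain ctrl δ₀ s) p with hf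
  have hopt : ∀ s' : V → V, (∀ u ∈ ctrl, E u (s' u)) →
      (∀ x, f x ≤ parityVal (pureChain ctrl δ₀ s') p x) →
      ∀ x, parityVal (pureChain ctrl δ₀ s') p x ≤ f x := by
    intro s' hs' hle x
    by_contra hlt
    exact absurd (hmax s' hs') (not_le.2 (Finset.sum_lt_sum (fun x _ => hle x)
      ⟨x, Finset.mem_univ x, not_le.1 hlt⟩))
  have hedge : ∀ u ∈ ctrl, ∀ w, E u w → f w ≤ f u := by
    intro u hu w hw
    by_contra hlt
    obtain ⟨s', hs', hle, hlt'⟩ := exists_parityVal_lt_of_edge ctrl E δ₀ p s hs hu hw (not_le.1 hlt)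
    exact absurd (hopt s' hs' hle u) (not_le.2 hlt')
  have hsuper : ∀ n (h : History V n), ∫ w, f w ∂(κ n h).toMeasure ≤ f h.last := by
    intro n h
    by_cases hc : h.last ∈ ctrl
    · refine (integral_toMeasure_mono (g := fun _ => f h.last) _ fun w hw =>
        hedge _ hc w (hκ.edge n h hc w hw)).trans ?_
      simp
    · rw [hκ.eq n h hc, hf, parityVal_harmonic _ p h.last, pureChain_of_notMem hc]
  -- Almost surely `infSet π` is an end component. If it is even, some policy has value 1 on it,
  -- hence so has the optimal `s`.
  have hgood : ∀ᵐ π ∂policyMeasure κ v, π ∈ evenSet p → ∀ᶠ n in atTop, f (π n) = 1 := by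
    have h1 : ∀ᵐ π ∂policyMeasure κ v, ∀ u w, u ∉ ctrl → w ∈ (δ₀ u).support → u ∈ infSet π →
        w ∈ infSet π := by
      refine ae_all_iff.2 fun u => ae_all_iff.2 fun w => ?_
      by_cases hw : u ∉ ctrl ∧ w ∈ (δ₀ u).support
      · filter_upwards [ae_mem_infSet_of_mem_support κ v u w (δ₀ u)
          (fun n h hh => by rw [hκ.eq n h (by rw [hh]; exact hw.1), hh]) hw.2]
          with π hπ _ _ using hπ
      · filter_upwards with π h h' using absurd ⟨h, h'⟩ hw
    filter_upwards [h1, ae_policyMeasure_mem_support κ v] with π hcl hsupp heven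
    have hR : ∀ n, mdpEdge ctrl E δ₀ (π n) (π (n + 1)) := fun n =>
      ⟨fun hc => hκ.edge n (hist n π) hc _ (hsupp n), fun hc => by
        have := hsupp n
        rwa [hκ.eq n (hist n π) hc] at this⟩
    obtain ⟨s', hs', hle, hone⟩ := exists_parityVal_eq_one ctrl E δ₀ p s hs (infSet_nonempty π)
      (fun u hu hc w hw => hcl u w hc hw hu)
      (fun u hu w hw => transGen_of_mem_infSet hR hu hw) heven
    filter_upwards [eventually_mem_infSet π] with n hn
    refine (parityVal_le_one _ p _).antisymm ?_
    rw [← hone _ hn]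
    exact hopt s' hs' hle _
  let B : ℕ → Set (ℕ → V) := fun N => {π | ∀ n ≥ N, f (π n) = 1}
  have hBmono : Monotone B := fun N M hNM π hπ n hn => hπ n (hNM.trans hn)
  -- `f` is superharmonic under every policy, so the mean of `f (π N)`, which dominates the
  -- probability of `B N`, is at most `f v`.
  have hBle : ∀ N, (policyMeasure κ v) (B N) ≤ ENNReal.ofReal (f v) := by
    intro N
    have hstep := integral_stoppedAt_le κ ∅ (fun _ => f) (fun _ _ _ => le_rfl)
      (fun n h _ => hsuper n h) v N
    simp only [stoppedAt_empty] at hstep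
    let C : Set (ℕ → V) := {π | f (π N) = 1}
    have hC : MeasurableSet C :=
      ((measurable_of_countable f).comp (measurable_pi_apply N)) (measurableSet_singleton 1)
    refine (measure_mono (show B N ⊆ C from fun π hπ => hπ N le_rfl)).trans ?_
    rw [← ofReal_measureReal]
    refine ENNReal.ofReal_le_ofReal (le_trans ?_ hstep)
    have had : Adapted N fun π : ℕ → V => f (π N) := fun π π' h => by simp only [h N le_rfl]
    rw [← integral_indicator_one hC]
    refine integral_mono ((integrable_const 1).indicator hC) (had.integrable _) fun π => ?_
    by_cases h : π ∈ C
    · simpa [Set.indicator, h] using (show f (π N) = 1 from h).ge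
    · simpa [Set.indicator, h] using parityVal_nonneg _ p _
  rw [measureReal_def]
  refine ENNReal.toReal_le_of_le_ofReal (parityVal_nonneg _ p v) ?_
  calc (policyMeasure κ v) (evenSet p) ≤ (policyMeasure κ v) (⋃ N, B N) := by
        refine measure_mono_ae ?_
        filter_upwards [hgood] with π hπ he
        obtain ⟨N, hN⟩ := eventually_atTop.1 (hπ he)
        exact Set.mem_iUnion.2 ⟨N, hN⟩
    _ = ⨆ N, (policyMeasure κ v) (B N) := hBmono.measure_iUnion
    _ ≤ _ := iSup_le hBle

end MDP

/-! ### Best responses to pure memoryless strategies in the parity game -/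

section Arena

variable {V : Type*} (G : StochasticArena V)

theorem nextDist_of_eve (σ : G.Strategy .eve) (γ : G.Strategy .adam) {n : ℕ} (h : History V n)
    (hv : G.owner h.last = some .eve) : G.nextDist σ γ h = σ.move n h hv := by
  unfold nextDist
  split <;> first | rfl | (rename_i e; exact nomatch e.symm.trans hv)

theorem nextDist_of_adam (σ : G.Strategy .eve) (γ : G.Strategy .adam) {n : ℕ} (h : History V n)
    (hv : G.owner h.last = some .adam) : G.nextDist σ γ h = γ.move n h hv := by
  unfold nextDist
  split <;> first | rfl | (rename_i e; exact nomatch e.symm.trans hv)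

theorem nextDist_of_random (σ : G.Strategy .eve) (γ : G.Strategy .adam) {n : ℕ} (h : History V n)
    (hv : G.owner h.last = none) : G.nextDist σ γ h = G.prob h.last hv := by
  unfold nextDist
  split <;> first | rfl | (rename_i e; exact nomatch e.symm.trans hv)

theorem chain_of_eve (σ : G.PureStrategy .eve) (γ : G.PureStrategy .adam) {u : V}
    (hu : G.owner u = some .eve) : G.chain σ γ u = PMF.pure (σ.next ⟨u, hu⟩) := by
  unfold chain
  split <;> first | rfl | (rename_i e; exact nomatch e.symm.trans hu)

theorem chain_of_adam (σ : G.PureStrategy .eve) (γ : G.PureStrategy .adam) {u : V}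
    (hu : G.owner u = some .adam) : G.chain σ γ u = PMF.pure (γ.next ⟨u, hu⟩) := by
  unfold chain
  split <;> first | rfl | (rename_i e; exact nomatch e.symm.trans hu)

theorem chain_of_random (σ : G.PureStrategy .eve) (γ : G.PureStrategy .adam) {u : V}
    (hu : G.owner u = none) : G.chain σ γ u = G.prob u hu := by
  unfold chain
  split <;> first | rfl | (rename_i e; exact nomatch e.symm.trans hu)

theorem edge_of_mem_support_nextDist (σ : G.Strategy .eve) (γ : G.Strategy .adam) {n : ℕ}
    (h : History V n) {w : V} (hw : w ∈ (G.nextDist σ γ h).support) : G.edge h.last w := by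
  rcases hv : G.owner h.last with _ | P
  · rw [nextDist_of_random G σ γ h hv] at hw
    exact (G.edge_iff_of_random _ hv w).2 hw
  · cases P with
    | eve =>
      rw [nextDist_of_eve G σ γ h hv] at hw
      exact σ.edge_of_mem_support n h hv w hw
    | adam =>
      rw [nextDist_of_adam G σ γ h hv] at hw
      exact γ.edge_of_mem_support n h hv w hw

theorem exists_pureStrategy (P : Player) (s : V → V)
    (hs : ∀ u, G.owner u = some P → G.edge u (s u)) :
    ∃ σ : G.PureStrategy P, ∀ u hu, σ.next ⟨u, hu⟩ = s u :=
  ⟨⟨fun u => s u.1, fun u => hs u.1 u.2⟩, fun _ _ => rfl⟩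

theorem nonempty_pureStrategy (P : Player) : Nonempty (G.PureStrategy P) := by
  choose s hs using G.nonblocking
  exact ⟨⟨fun u => s u.1, fun u => hs u.1⟩⟩

instance [Finite V] (P : Player) : Finite (G.PureStrategy P) :=
  Finite.of_injective PureStrategy.next fun _ _ h => PureStrategy.ext h

variable [Finite V] [MeasurableSpace V] [DiscreteMeasurableSpace V]

theorem ae_mem_plays (σ : G.Strategy .eve) (γ : G.Strategy .adam) (v : V) :
    ∀ᵐ π ∂G.playMeasure σ γ v, π ∈ G.plays := by
  rw [playMeasure_eq_policyMeasure]
  filter_upwards [ae_policyMeasure_mem_support (fun _ h => G.nextDist σ γ h) v] with π hπ i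
  exact edge_of_mem_support_nextDist G σ γ _ (hπ i)

instance (σ : G.Strategy .eve) (γ : G.Strategy .adam) (v : V) :
    IsProbabilityMeasure (G.playMeasure σ γ v) :=
  inferInstanceAs (IsProbabilityMeasure (policyMeasure _ v))

/-- Almost every sequence follows the edges, so objectives need not mention plays from here on. -/
theorem playMeasure_sep_plays (σ : G.Strategy .eve) (γ : G.Strategy .adam) (v : V)
    (A : Set (ℕ → V)) : G.playMeasure σ γ v {π ∈ G.plays | π ∈ A} = G.playMeasure σ γ v A := by
  refine measure_congr ?_
  filter_upwards [ae_mem_plays G σ γ v] with π hπ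
  exact propext ⟨fun h => h.2, fun h => ⟨hπ, h⟩⟩

theorem playMeasure_plays_diff (σ : G.Strategy .eve) (γ : G.Strategy .adam) (v : V)
    {A : Set (ℕ → V)} (hA : MeasurableSet A) :
    G.playMeasure σ γ v (G.plays \ {π ∈ G.plays | π ∈ A}) = 1 - G.playMeasure σ γ v A := by
  rw [← prob_compl_eq_one_sub hA]
  refine measure_congr ?_
  filter_upwards [ae_mem_plays G σ γ v] with π hπ
  exact propext ⟨fun h hA => h.2 ⟨hπ, hA⟩, fun h => ⟨hπ, fun h' => h h'.2⟩⟩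

/-- Against a pure memoryless strategy of Adam, Eve has a pure memoryless optimal strategy in the
parity game. -/
theorem exists_eve_response (p : V → ℕ) (γ : G.PureStrategy .adam) :
    ∃ σ : G.PureStrategy .eve, ∀ (σ' : G.Strategy .eve) (v : V),
      (G.playMeasure σ' γ.toStrategy v).real (evenSet p) ≤ parityVal (G.chain σ γ) p v := by
  obtain ⟨σ₀⟩ := G.nonempty_pureStrategy .eve
  obtain ⟨s, hs, hopt⟩ := exists_optimal_pureChain {u | G.owner u = some .eve} G.edge
    (G.chain σ₀ γ) p fun u _ => G.nonblocking u
  obtain ⟨σ, hσ⟩ := G.exists_pureStrategy .eve s hs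
  have hchain : pureChain {u | G.owner u = some .eve} (G.chain σ₀ γ) s = G.chain σ γ := by
    funext u
    rcases hu : G.owner u with _ | P
    · rw [pureChain_of_notMem (by simp [hu]), chain_of_random G σ₀ γ hu, chain_of_random G σ γ hu]
    · cases P with
      | eve => rw [pureChain_of_mem (by simpa using hu), chain_of_eve G σ γ hu, hσ]
      | adam =>
        rw [pureChain_of_notMem (by simp [hu]), chain_of_adam G σ₀ γ hu, chain_of_adam G σ γ hu]
  refine ⟨σ, fun σ' v => ?_⟩
  rw [← hchain, playMeasure_eq_policyMeasure]
  refine hopt _ ⟨fun n h hc w hw => edge_of_mem_support_nextDist G σ' _ h hw, fun n h hc => ?_⟩ v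
  rcases hu : G.owner h.last with _ | P
  · rw [nextDist_of_random G _ _ h hu, chain_of_random G _ _ hu]
  · cases P with
    | eve => exact absurd hu hc
    | adam =>
      rw [nextDist_of_adam G _ _ h hu, chain_of_adam G _ _ hu]
      rfl

/-- Against a pure memoryless strategy of Eve, Adam has a pure memoryless optimal strategy in the
parity game. -/
theorem exists_adam_response (p : V → ℕ) (σ : G.PureStrategy .eve) :
    ∃ γ : G.PureStrategy .adam, ∀ (γ' : G.Strategy .adam) (v : V),
      parityVal (G.chain σ γ) p v ≤ (G.playMeasure σ.toStrategy γ' v).real (evenSet p) := by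
  obtain ⟨γ₀⟩ := G.nonempty_pureStrategy .adam
  -- Adam maximizes the complementary objective, whence the shifted priorities.
  obtain ⟨s, hs, hopt⟩ := exists_optimal_pureChain {u | G.owner u = some .adam} G.edge
    (G.chain σ γ₀) (fun v => p v + 1) fun u _ => G.nonblocking u
  obtain ⟨γ, hγ⟩ := G.exists_pureStrategy .adam s hs
  have hchain : pureChain {u | G.owner u = some .adam} (G.chain σ γ₀) s = G.chain σ γ := by
    funext u
    rcases hu : G.owner u with _ | P
    · rw [pureChain_of_notMem (by simp [hu]), chain_of_random G σ γ₀ hu, chain_of_random G σ γ hu]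
    · cases P with
      | adam => rw [pureChain_of_mem (by simpa using hu), chain_of_adam G σ γ hu, hγ]
      | eve =>
        rw [pureChain_of_notMem (by simp [hu]), chain_of_eve G σ γ₀ hu, chain_of_eve G σ γ hu]
  refine ⟨γ, fun γ' v => ?_⟩
  have h := hopt (fun _ h => G.nextDist σ.toStrategy γ' h)
    ⟨fun n h hc w hw => edge_of_mem_support_nextDist G _ γ' h hw, fun n h hc => ?_⟩ v
  · rw [hchain, parityVal, measureReal_evenSet_add_one, measureReal_evenSet_add_one] at h
    rw [playMeasure_eq_policyMeasure, parityVal]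
    linarith
  · rcases hu : G.owner h.last with _ | P
    · rw [nextDist_of_random G _ _ h hu, chain_of_random G _ _ hu]
    · cases P with
      | adam => exact absurd hu hc
      | eve =>
        rw [nextDist_of_eve G _ _ h hu, chain_of_eve G _ _ hu]
        rfl

end Arena

/-! ### Reachability games by discounting -/

section Discounted

variable {V : Type*} (G : StochasticArena V) [Finite V] [MeasurableSpace V]
  [DiscreteMeasurableSpace V]

/-- The one-step optimization of the players. -/
noncomputable def optStep (f : V → ℝ) (u : V) : ℝ :=
  match hu : G.owner u with
  | some .eve => sSup (f '' {w | G.edge u w})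
  | some .adam => sInf (f '' {w | G.edge u w})
  | none => ∫ w, f w ∂(G.prob u hu).toMeasure

theorem optStep_of_eve (f : V → ℝ) {u : V} (hu : G.owner u = some .eve) :
    optStep G f u = sSup (f '' {w | G.edge u w}) := by
  unfold optStep
  split <;> first | rfl | (rename_i e; exact nomatch e.symm.trans hu)

theorem optStep_of_adam (f : V → ℝ) {u : V} (hu : G.owner u = some .adam) :
    optStep G f u = sInf (f '' {w | G.edge u w}) := by
  unfold optStep
  split <;> first | rfl | (rename_i e; exact nomatch e.symm.trans hu)

theorem optStep_of_random (f : V → ℝ) {u : V} (hu : G.owner u = none) :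
    optStep G f u = ∫ w, f w ∂(G.prob u hu).toMeasure := by
  unfold optStep
  split <;> first | rfl | (rename_i e; exact nomatch e.symm.trans hu)

/-- Monotonicity and subadditivity in constants at once; applied in both directions it makes the
operator nonexpansive for the supremum norm. -/
theorem optStep_le_add {f g : V → ℝ} {c : ℝ} (h : ∀ w, f w ≤ g w + c) (u : V) :
    optStep G f u ≤ optStep G g u + c := by
  have hbdd : ∀ f : V → ℝ, BddAbove (f '' {w | G.edge u w}) ∧ BddBelow (f '' {w | G.edge u w}) :=
    fun f => ⟨(Set.toFinite _).bddAbove, (Set.toFinite _).bddBelow⟩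
  have hne : ∀ f : V → ℝ, (f '' {w | G.edge u w}).Nonempty := fun f =>
    Set.Nonempty.image f (G.nonblocking u)
  rcases hu : G.owner u with _ | P
  · rw [optStep_of_random G f hu, optStep_of_random G g hu]
    calc ∫ w, f w ∂(G.prob u hu).toMeasure ≤ ∫ w, (g w + c) ∂(G.prob u hu).toMeasure :=
          integral_toMeasure_mono _ fun w _ => h w
      _ = _ := by
          rw [integral_add .of_finite .of_finite]
          simp
  · cases P with
    | eve =>
      rw [optStep_of_eve G f hu, optStep_of_eve G g hu]
      refine csSup_le (hne f) ?_
      rintro _ ⟨w, hw, rfl⟩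
      exact (h w).trans (add_le_add_left (le_csSup (hbdd g).1 ⟨w, hw, rfl⟩) c)
    | adam =>
      rw [optStep_of_adam G f hu, optStep_of_adam G g hu, ← sub_le_iff_le_add]
      refine le_csInf (hne g) ?_
      rintro _ ⟨w, hw, rfl⟩
      rw [sub_le_iff_le_add]
      exact (csInf_le (hbdd f).2 ⟨w, hw, rfl⟩).trans (h w)

theorem optStep_const (c : ℝ) (u : V) : optStep G (fun _ => c) u = c := by
  have hne : {w | G.edge u w}.Nonempty := G.nonblocking u
  rcases hu : G.owner u with _ | P
  · simp [optStep_of_random G _ hu]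
  · cases P with
    | eve => rw [optStep_of_eve G _ hu, hne.image_const, csSup_singleton]
    | adam => rw [optStep_of_adam G _ hu, hne.image_const, csInf_singleton]

/-- The value function of the reachability game with the target `t` and discount factor `r`. -/
theorem exists_discounted_value (t : V) {r : ℝ} (hr0 : 0 ≤ r) (hr1 : r < 1) :
    ∃ f : V → ℝ, f t = 1 ∧ (∀ x, x ≠ t → f x = r * optStep G f x) ∧ (∀ x, 0 ≤ f x) ∧
      ∀ x, f x ≤ 1 := by
  classical
  have := Fintype.ofFinite V
  -- The discounted Bellman operator contracts by `r`; its fixed point is the value.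
  let B : (V → ℝ) → V → ℝ := fun f x => if x = t then 1 else r * optStep G f x
  have hB : ContractingWith ⟨r, hr0⟩ B := by
    refine ⟨by exact_mod_cast hr1, LipschitzWith.of_dist_le_mul fun f g => ?_⟩
    change dist (B f) (B g) ≤ r * dist f g
    rw [dist_pi_le_iff (mul_nonneg hr0 dist_nonneg)]
    intro x
    by_cases hx : x = t
    · simpa [B, hx] using mul_nonneg hr0 dist_nonneg
    · have hd : ∀ w, |f w - g w| ≤ dist f g := fun w => dist_le_pi_dist f g w
      have h1 := optStep_le_add G (f := f) (g := g) (c := dist f g)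
        (fun w => by linarith [(abs_le.1 (hd w)).2]) x
      have h2 := optStep_le_add G (f := g) (g := f) (c := dist f g)
        (fun w => by linarith [(abs_le.1 (hd w)).1]) x
      simp only [B, hx, if_false, Real.dist_eq]
      rw [← mul_sub, abs_mul, abs_of_nonneg hr0]
      exact mul_le_mul_of_nonneg_left (abs_le.2 ⟨by linarith, by linarith⟩) hr0
  let f := ContractingWith.fixedPoint B hB
  have hf : B f = f := hB.fixedPoint_isFixedPt
  have hft : f t = 1 := by rw [← hf]; simp [B]
  have hfx : ∀ x, x ≠ t → f x = r * optStep G f x := fun x hx => by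
    conv_lhs => rw [← hf]
    simp [B, hx]
  have : Nonempty V := ⟨t⟩
  refine ⟨f, hft, hfx, ?_, ?_⟩
  -- At a minimum `m ≠ t` one has `f m ≥ r * f m`, so `f m ≥ 0`; the upper bound is dual.
  · obtain ⟨m, hm⟩ := Finite.exists_min f
    refine fun x => le_trans ?_ (hm x)
    by_contra hneg
    have hmt : m ≠ t := fun h => by rw [h, hft] at hneg; linarith
    have h1 := optStep_le_add G (f := fun _ => f m) (g := f) (c := 0)
      (fun w => by simpa using hm w) m
    rw [optStep_const, add_zero] at h1
    have h2 := mul_le_mul_of_nonneg_left h1 hr0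
    rw [← hfx m hmt] at h2
    nlinarith
  · obtain ⟨m, hm⟩ := Finite.exists_max f
    refine fun x => (hm x).trans ?_
    by_contra hgt
    have hmt : m ≠ t := fun h => by rw [h, hft] at hgt; linarith
    have h1 := optStep_le_add G (g := fun _ => f m) (f := f) (c := 0)
      (fun w => by simpa using hm w) m
    rw [optStep_const, add_zero] at h1
    have h2 := mul_le_mul_of_nonneg_left h1 hr0
    rw [← hfx m hmt] at h2
    nlinarith

/-- Both strategies are greedy for the discounted value `f`. Eve's makes the discounted process a
submartingale, so `f x` is at most the probability of reaching `t` within `n` steps plus `r ^ n`;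
Adam's makes it a supermartingale. -/
theorem exists_discounted_optimal (t : V) {r : ℝ} (hr0 : 0 ≤ r) (hr1 : r < 1) :
    ∃ (σ : G.PureStrategy .eve) (γ : G.PureStrategy .adam) (f : V → ℝ),
      (∀ (γ' : G.Strategy .adam) x, f x ≤
        (G.playMeasure σ.toStrategy γ' x).real {π | ∃ k, π k ∈ ({t} : Set V)}) ∧
      ∀ (σ' : G.Strategy .eve) x n, r ^ n *
        (G.playMeasure σ' γ.toStrategy x).real {π | stoppedAt {t} n π ∈ ({t} : Set V)} ≤ f x := by
  classical
  obtain ⟨f, hft, hfx, hf0, hf1⟩ := exists_discounted_value G t hr0 hr1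
  have hmax : ∀ u, ∃ w, G.edge u w ∧ ∀ w', G.edge u w' → f w' ≤ f w := fun u =>
    Set.exists_max_image {w | G.edge u w} f (Set.toFinite _) (G.nonblocking u)
  have hmin : ∀ u, ∃ w, G.edge u w ∧ ∀ w', G.edge u w' → f w ≤ f w' := fun u =>
    Set.exists_min_image {w | G.edge u w} f (Set.toFinite _) (G.nonblocking u)
  choose s hs hsmax using hmax
  choose g hg hgmin using hmin
  obtain ⟨σ, hσ⟩ := G.exists_pureStrategy .eve s fun u _ => hs u
  obtain ⟨γ, hγ⟩ := G.exists_pureStrategy .adam g fun u _ => hg u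
  have heve : ∀ u, G.owner u = some .eve → optStep G f u = f (s u) := by
    intro u hu
    rw [optStep_of_eve G f hu]
    refine IsGreatest.csSup_eq ⟨⟨s u, hs u, rfl⟩, ?_⟩
    rintro _ ⟨w, hw, rfl⟩
    exact hsmax u w hw
  have hadam : ∀ u, G.owner u = some .adam → optStep G f u = f (g u) := by
    intro u hu
    rw [optStep_of_adam G f hu]
    refine IsLeast.csInf_eq ⟨⟨g u, hg u, rfl⟩, ?_⟩
    rintro _ ⟨w, hw, rfl⟩
    exact hgmin u w hw
  have hlow : ∀ (γ' : G.Strategy .adam) n (h : History V n),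
      optStep G f h.last ≤ ∫ w, f w ∂(G.nextDist σ.toStrategy γ' h).toMeasure := by
    intro γ' n h
    rcases hu : G.owner h.last with _ | P
    · rw [optStep_of_random G f hu, nextDist_of_random G _ _ h hu]
    · cases P with
      | eve =>
        rw [heve _ hu, nextDist_of_eve G _ _ h hu]
        change _ ≤ ∫ w, f w ∂(PMF.pure (σ.next ⟨h.last, hu⟩)).toMeasure
        rw [integral_toMeasure_pure, hσ]
      | adam =>
        rw [hadam _ hu, nextDist_of_adam G _ _ h hu]
        refine le_trans (by simp) (integral_toMeasure_mono (f := fun _ => f (g h.last)) _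
          fun w hw => hgmin _ w (γ'.edge_of_mem_support n h hu w hw))
  have hupp : ∀ (σ' : G.Strategy .eve) n (h : History V n),
      ∫ w, f w ∂(G.nextDist σ' γ.toStrategy h).toMeasure ≤ optStep G f h.last := by
    intro σ' n h
    rcases hu : G.owner h.last with _ | P
    · rw [optStep_of_random G f hu, nextDist_of_random G _ _ h hu]
    · cases P with
      | adam =>
        rw [hadam _ hu, nextDist_of_adam G _ _ h hu]
        change ∫ w, f w ∂(PMF.pure (γ.next ⟨h.last, hu⟩)).toMeasure ≤ _
        rw [integral_toMeasure_pure, hγ]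
      | eve =>
        rw [heve _ hu, nextDist_of_eve G _ _ h hu]
        refine le_trans (integral_toMeasure_mono (g := fun _ => f (s h.last)) _
          fun w hw => hsmax _ w (σ'.edge_of_mem_support n h hu w hw)) (by simp)
  refine ⟨σ, γ, f, fun γ' x => ?_, fun σ' x n => ?_⟩
  · rw [playMeasure_eq_policyMeasure]
    set κ := fun n (h : History V n) => G.nextDist σ.toStrategy γ' h
    have hlim : Tendsto (fun n => (policyMeasure κ x).real {π | stoppedAt {t} n π ∈ ({t} : Set V)} +
        r ^ n) atTop (𝓝 ((policyMeasure κ x).real {π | ∃ k, π k ∈ ({t} : Set V)} + 0)) :=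
      (tendsto_measureReal_stoppedAt_mem _ _).add (tendsto_pow_atTop_nhds_zero_of_lt_one hr0 hr1)
    rw [add_zero] at hlim
    refine ge_of_tendsto' hlim fun n => ?_
    -- The target keeps the undiscounted weight 1, since the bound concerns the plain reachability
    -- probability.
    have hstep := le_integral_stoppedAt κ {t} (fun n y => if y = t then 1 else r ^ n * f y)
      (fun n y hy => by simp [Set.mem_singleton_iff.1 hy]) (fun n h hh => ?_) x n
    · have hx : (if x = t then 1 else r ^ 0 * f x) = f x := by
        split_ifs with h
        · rw [h, hft]
        · simp
      rw [hx] at hstep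
      refine hstep.trans ?_
      have had : Adapted n fun π =>
          if stoppedAt {t} n π = t then 1 else r ^ n * f (stoppedAt {t} n π) := by
        intro π π' h
        simp only [adapted_stoppedAt {t} n π π' h]
      have hm := measurableSet_stoppedAt_mem {t} ({t} : Set V) n
      have hi : Integrable ({π | stoppedAt {t} n π ∈ ({t} : Set V)}.indicator (1 : (ℕ → V) → ℝ))
        (policyMeasure κ x) := (integrable_const 1).indicator hm
      calc _ ≤ ∫ π, ({π | stoppedAt {t} n π ∈ ({t} : Set V)}.indicator (1 : (ℕ → V) → ℝ) π + r ^ n)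
            ∂policyMeasure κ x := by
            refine integral_mono (had.integrable _) (hi.add (integrable_const _)) fun π => ?_
            by_cases h : stoppedAt {t} n π = t
            · simpa [Set.indicator, h] using pow_nonneg hr0 n
            · simpa [Set.indicator, h] using
                mul_le_of_le_one_right (pow_nonneg hr0 n) (hf1 _)
        _ = _ := by
            rw [integral_add hi (integrable_const _), integral_indicator_one hm]
            simp
    · have hne : h.last ≠ t := hh
      simp only [hne, if_false]
      rw [hfx _ hne, ← mul_assoc, ← pow_succ]
      refine (mul_le_mul_of_nonneg_left (hlow γ' n h) (pow_nonneg hr0 _)).trans ?_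
      rw [← integral_const_mul]
      refine integral_toMeasure_mono _ fun w _ => ?_
      split_ifs with hw
      · rw [hw, hft, mul_one]
        exact pow_le_one₀ hr0 hr1.le
      · exact le_rfl
  · rw [playMeasure_eq_policyMeasure]
    set κ := fun n (h : History V n) => G.nextDist σ' γ.toStrategy h
    have hstep := integral_stoppedAt_le κ {t} (fun n y => r ^ n * f y)
      (fun n y _ => mul_le_mul_of_nonneg_right
        (pow_le_pow_of_le_one hr0 hr1.le n.le_succ) (hf0 y)) (fun n h hh => ?_) x n
    · rw [pow_zero, one_mul] at hstep
      refine le_trans ?_ hstep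
      have had : Adapted n fun π => r ^ n * f (stoppedAt {t} n π) := by
        intro π π' h
        simp only [adapted_stoppedAt {t} n π π' h]
      have hm := measurableSet_stoppedAt_mem {t} ({t} : Set V) n
      rw [mul_comm, ← smul_eq_mul, ← integral_indicator_const _ hm]
      refine integral_mono ((integrable_const _).indicator hm) (had.integrable _) fun π => ?_
      by_cases h : stoppedAt {t} n π = t
      · simp [Set.indicator, h, hft]
      · simpa [Set.indicator, h] using mul_nonneg (pow_nonneg hr0 n) (hf0 _)
    · have hne : h.last ≠ t := hh
      rw [integral_const_mul, hfx _ hne, ← mul_assoc, ← pow_succ]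
      exact mul_le_mul_of_nonneg_left (hupp σ' n h) (pow_nonneg hr0 _)

/-- Reachability games are determined, and both players have pure memoryless optimal strategies. -/
theorem exists_reach_saddle (t : V) :
    ∃ (σ : G.PureStrategy .eve) (γ : G.PureStrategy .adam),
      ∀ (σ' : G.Strategy .eve) (γ' : G.Strategy .adam) x,
        (G.playMeasure σ' γ.toStrategy x).real {π | ∃ k, π k ∈ ({t} : Set V)} ≤
          (G.playMeasure σ.toStrategy γ' x).real {π | ∃ k, π k ∈ ({t} : Set V)} := by
  let r : ℕ → ℝ := fun k => 1 - 1 / ((k : ℝ) + 1)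
  have hr0 : ∀ k, 0 ≤ r k := fun k => by
    have : 1 / ((k : ℝ) + 1) ≤ 1 := by
      rw [div_le_one (by positivity)]
      linarith [(Nat.cast_nonneg k : (0 : ℝ) ≤ k)]
    simp only [r]
    linarith
  have hr1 : ∀ k, r k < 1 := fun k => by
    have : 0 < 1 / ((k : ℝ) + 1) := by positivity
    simp only [r]
    linarith
  have hr : Tendsto r atTop (𝓝 1) := by
    simpa [r] using
      (tendsto_const_nhds (x := (1 : ℝ))).sub (tendsto_one_div_add_atTop_nhds_zero_nat (𝕜 := ℝ))
  choose σ γ f hσ hγ using fun k => exists_discounted_optimal G t (hr0 k) (hr1 k)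
  -- There are finitely many pure memoryless pairs, so one is optimal for infinitely many discount
  -- factors tending to 1.
  obtain ⟨⟨σ₀, γ₀⟩, hinf⟩ := Finite.exists_infinite_fiber fun k => (σ k, γ k)
  rw [Set.infinite_coe_iff] at hinf
  refine ⟨σ₀, γ₀, fun σ' γ' x => le_of_tendsto' (tendsto_measureReal_stoppedAt_mem _ _) fun n => ?_⟩
  have hlim : Tendsto (fun k => r k ^ n * (G.playMeasure σ' γ₀.toStrategy x).real
      {π | stoppedAt {t} n π ∈ ({t} : Set V)}) atTop
      (𝓝 (1 ^ n * (G.playMeasure σ' γ₀.toStrategy x).real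
        {π | stoppedAt {t} n π ∈ ({t} : Set V)})) := (hr.pow n).mul_const _
  rw [one_pow, one_mul] at hlim
  -- With the horizon `n` fixed, the discount factor tends to 1 along these indices.
  refine le_of_tendsto_of_frequently hlim ?_
  refine (Nat.frequently_atTop_iff_infinite.2 hinf).mono fun k hk => ?_
  obtain ⟨h1, h2⟩ := Prod.mk.inj hk
  have := (hγ k σ' x n).trans (hσ k γ' x)
  rwa [h1, h2] at this

end Discounted

/-! ### Comparing the gadget with the parity game -/

open GadgetVertex

theorem integral_mix {W : Type*} [Finite W] [MeasurableSpace W] [DiscreteMeasurableSpace W]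
    (q : unitInterval) (x y : W) (f : W → ℝ) :
    ∫ z, f z ∂(mix q x y).toMeasure = q * f x + (1 - q) * f y := by
  have h0 : (0 : ℝ) ≤ q := q.2.1
  have h1 : (0 : ℝ) ≤ 1 - q := sub_nonneg.2 q.2.2
  rw [mix, ← PMF.toMeasure_map _ _ (measurable_of_countable _),
    integral_map (measurable_of_countable _).aemeasurable
      (measurable_of_countable _).aestronglyMeasurable, integral_toMeasure_eq_sum]
  simp [coin, ENNReal.toReal_ofReal h0, ENNReal.toReal_ofReal h1]

section Gadget

variable {V : Type*} (G : StochasticArena V) (p : V → ℕ) (α : ℕ → unitInterval)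
  (σ : G.PureStrategy .eve) (γ : G.PureStrategy .adam)

/-- The Markov chain on the gadget that two pure memoryless strategies induce. -/
noncomputable def gadgetChain : GadgetVertex V → PMF (GadgetVertex V) :=
  (G.gadget p α).chain (σ.lift p α) (γ.lift p α)

theorem gadgetChain_bar (u : V) : gadgetChain G p α σ γ (bar u) = (G.chain σ γ u).map hat := by
  rcases hu : G.owner u with _ | P
  · rw [chain_of_random G σ γ hu]
    exact chain_of_random (G.gadget p α) (u := bar u) _ _ hu
  · cases P with
    | eve =>
      rw [chain_of_eve G σ γ hu, PMF.pure_map]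
      exact chain_of_eve (G.gadget p α) (u := bar u) _ _ hu
    | adam =>
      rw [chain_of_adam G σ γ hu, PMF.pure_map]
      exact chain_of_adam (G.gadget p α) (u := bar u) _ _ hu

theorem gadgetChain_hat (u : V) :
    gadgetChain G p α σ γ (hat u) = mix (α (p u)) (sink (p u)) (bar u) :=
  chain_of_random (G.gadget p α) (u := hat u) _ _ rfl

theorem gadgetChain_win : gadgetChain G p α σ γ win = PMF.pure win :=
  chain_of_random (G.gadget p α) (u := win) _ _ rfl

theorem gadgetChain_lose : gadgetChain G p α σ γ lose = PMF.pure lose :=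
  chain_of_random (G.gadget p α) (u := lose) _ _ rfl

variable [Finite V]

theorem gadgetMeasure_eq_chainMeasure (x : GadgetVertex V) :
    G.gadgetMeasure p α σ γ x = chainMeasure (gadgetChain G p α σ γ) x := rfl

instance (x : GadgetVertex V) : IsProbabilityMeasure (G.gadgetMeasure p α σ γ x) := by
  rw [gadgetMeasure_eq_chainMeasure]
  infer_instance

theorem integral_gadgetChain_bar [MeasurableSpace V] [DiscreteMeasurableSpace V] (u : V)
    (f : GadgetVertex V → ℝ) :
    ∫ y, f y ∂(gadgetChain G p α σ γ (bar u)).toMeasure =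
      ∫ w, f (hat w) ∂(G.chain σ γ u).toMeasure := by
  rw [gadgetChain_bar, ← PMF.toMeasure_map _ _ (measurable_of_countable _),
    integral_map (measurable_of_countable _).aemeasurable
      (measurable_of_countable _).aestronglyMeasurable]

/-- Extended by 0 to the sinks, `h` stays superharmonic in the gadget: a detour to a sink only loses
mass. -/
theorem measureReal_reach_tilde_le [MeasurableSpace V] [DiscreteMeasurableSpace V] (T : Set V)
    (h : V → ℝ) (h0 : ∀ u, 0 ≤ h u) (hT : ∀ u ∈ T, 1 ≤ h u)
    (hh : ∀ u, ∫ w, h w ∂(G.chain σ γ u).toMeasure ≤ h u) (v : V) :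
    (G.gadgetMeasure p α σ γ (bar v)).real {π | ∃ k, π k ∈ tilde T} ≤ h v := by
  let g : GadgetVertex V → ℝ := fun y => match y with
    | bar u => h u
    | hat u => h u
    | _ => 0
  have hsink : ∀ k, g (sink k) = 0 := by
    intro k
    unfold sink
    split_ifs <;> rfl
  refine measureReal_reach_le (fun _ h => gadgetChain G p α σ γ h.last) (tilde T) g ?_ ?_ ?_ (bar v)
  · rintro (u | u | _ | _)
    exacts [h0 u, h0 u, le_rfl, le_rfl]
  · rintro _ (⟨u, hu, rfl⟩ | ⟨u, hu, rfl⟩) <;> exact hT u hu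
  · intro n l _
    rcases l.last with u | u | _ | _
    · rw [integral_gadgetChain_bar]
      exact hh u
    · rw [gadgetChain_hat, integral_mix, hsink, mul_zero, zero_add]
      exact mul_le_of_le_one_left (h0 u) (sub_le_self 1 (α (p u)).2.1)
    · rw [gadgetChain_win, integral_toMeasure_pure]
    · rw [gadgetChain_lose, integral_toMeasure_pure]

/-- The probability to reach the winning sink. -/
noncomputable def winProb (x : GadgetVertex V) : ℝ :=
  (G.gadgetMeasure p α σ γ x).real {π | ∃ k, π k = win}

/-- As the winning sink is absorbing, reaching it is the parity condition with priority 0 there and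
1 elsewhere, so `parityVal_harmonic` applies. -/
theorem winProb_harmonic (x : GadgetVertex V) :
    winProb G p α σ γ x = ∫ y, winProb G p α σ γ y ∂(gadgetChain G p α σ γ x).toMeasure := by
  classical
  let q : GadgetVertex V → ℕ := fun y => if y = win then 0 else 1
  have h : winProb G p α σ γ = parityVal (gadgetChain G p α σ γ) q := by
    funext y
    refine congrArg ENNReal.toReal (measure_congr ?_)
    filter_upwards [ae_policyMeasure_mem_support
      (fun _ h => gadgetChain G p α σ γ h.last) y] with π hπ
    refine propext (?_ : (∃ k, π k = win) ↔ Even (sInf (q '' infSet π)))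
    constructor
    · rintro ⟨k, hk⟩
      have habs : ∀ n ≥ k, π n = win := by
        intro n hn
        induction n, hn using Nat.le_induction with
        | base => exact hk
        | succ n _ ih =>
          have := hπ n
          simpa [ih, gadgetChain_win] using this
      have hmem : win ∈ infSet π := fun n => ⟨k, habs _ (Nat.le_add_left k n)⟩
      have : sInf (q '' infSet π) = 0 := Nat.le_zero.1 (Nat.sInf_le ⟨win, hmem, by simp [q]⟩)
      rw [this]
      exact Even.zero
    · intro he
      obtain ⟨u, hu, hqu⟩ := Nat.sInf_mem ((infSet_nonempty π).image q)
      rw [← hqu] at he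
      have huw : u = win := by
        by_contra hne
        simp [q, hne] at he
      obtain ⟨k, hk⟩ := hu 0
      exact ⟨_, hk.trans huw⟩
  rw [h]
  exact parityVal_harmonic _ q x

/-- Stop at the first visit to `T`. Not having reached `T` or having stopped in `S` costs at most 1,
having stopped in `T` outside `S` at most `c`. -/
theorem winProb_le_of_cross (T S : Set (GadgetVertex V)) (c : ℝ) (hc : 0 ≤ c)
    (hT : ∀ y ∈ T, y ∉ S → winProb G p α σ γ y ≤ c) (x : GadgetVertex V) :
    winProb G p α σ γ x ≤ 1 - (G.gadgetMeasure p α σ γ x).real {π | ∃ k, π k ∈ T} +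
      (G.gadgetMeasure p α σ γ x).real {π | ∃ k, π k ∈ S} + c := by
  set μ := chainMeasure (gadgetChain G p α σ γ) x
  have hlim : Tendsto (fun n => 1 - μ.real {π | stoppedAt T n π ∈ T} +
      μ.real {π | ∃ k, π k ∈ S} + c) atTop
      (𝓝 (1 - μ.real {π | ∃ k, π k ∈ T} + μ.real {π | ∃ k, π k ∈ S} + c)) :=
    ((tendsto_const_nhds.sub (tendsto_measureReal_stoppedAt_mem μ T)).add_const _).add_const _
  refine ge_of_tendsto' hlim fun n => ?_
  have hstep := le_integral_stoppedAt (fun _ h => gadgetChain G p α σ γ h.last) T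
    (fun _ => winProb G p α σ γ) (fun _ _ _ => le_rfl)
    (fun n h _ => (winProb_harmonic G p α σ γ h.last).le) x n
  refine hstep.trans ?_
  have had : Adapted n fun π => winProb G p α σ γ (stoppedAt T n π) := fun π π' h => by
    simp only [adapted_stoppedAt T n π π' h]
  have hmT := (measurableSet_stoppedAt_mem T T n).compl
  have hmS := measurableSet_reach S
  let A : (ℕ → GadgetVertex V) → ℝ := {π | stoppedAt T n π ∈ T}ᶜ.indicator 1
  let B : (ℕ → GadgetVertex V) → ℝ := {π | ∃ k, π k ∈ S}.indicator 1
  have hA : Integrable A μ := (integrable_const 1).indicator hmT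
  have hB : Integrable B μ := (integrable_const 1).indicator hmS
  calc ∫ π, winProb G p α σ γ (stoppedAt T n π) ∂μ ≤ ∫ π, (A π + B π + c) ∂μ := by
        refine integral_mono (had.integrable _) ((hA.add hB).add (integrable_const c)) fun π => ?_
        have hA0 : 0 ≤ A π := Set.indicator_nonneg (fun _ _ => zero_le_one) _
        have hB0 : 0 ≤ B π := Set.indicator_nonneg (fun _ _ => zero_le_one) _
        have h1 : winProb G p α σ γ (stoppedAt T n π) ≤ 1 := measureReal_le_one
        by_cases hπ : stoppedAt T n π ∈ T
        · by_cases hS : stoppedAt T n π ∈ S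
          · obtain ⟨k, _, hk⟩ := exists_stoppedAt_eq T n π
            have : B π = 1 := Set.indicator_of_mem
              (show π ∈ {π : ℕ → GadgetVertex V | ∃ k, π k ∈ S} from ⟨k, hk ▸ hS⟩) _
            simp only
            linarith
          · have := hT _ hπ hS
            simp only
            linarith
        · have : A π = 1 := Set.indicator_of_mem (show π ∈ {π | stoppedAt T n π ∈ T}ᶜ from hπ) _
          simp only
          linarith
    _ = _ := by
        refine (integral_add (f := fun π => A π + B π) (hA.add hB) (integrable_const c)).trans ?_
        rw [integral_add hA hB,
          integral_indicator_one hmT, integral_indicator_one hmS,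
          probReal_compl_eq_one_sub (measurableSet_stoppedAt_mem T T n)]
        simp

/-- `winProb / c` is harmonic and at least 1 on `S`, so it dominates the probability of reaching
`S`. -/
theorem mul_measureReal_reach_le_winProb (S : Set (GadgetVertex V)) (c : ℝ) (hc : 0 < c)
    (hS : ∀ y ∈ S, c ≤ winProb G p α σ γ y) (x : GadgetVertex V) :
    c * (G.gadgetMeasure p α σ γ x).real {π | ∃ k, π k ∈ S} ≤ winProb G p α σ γ x := by
  rw [mul_comm, ← le_div_iff₀ hc]
  refine measureReal_reach_le (fun _ h => gadgetChain G p α σ γ h.last) S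
    (fun y => winProb G p α σ γ y / c) (fun y => div_nonneg measureReal_nonneg hc.le)
    (fun y hy => (one_le_div hc).2 (hS y hy)) (fun n h _ => ?_) x
  rw [integral_div, ← winProb_harmonic]

/-- The reachability probabilities of the gadget approximate the parity probabilities. -/
theorem abs_winProb_sub_parityVal_lt [MeasurableSpace V] [DiscreteMeasurableSpace V] {ε : ℝ}
    (hε0 : 0 < ε) (hε1 : ε ≤ 1) (v : V)
    (hcross : ENNReal.ofReal ((4 - ε) / 4) < G.crossPath p α σ γ v)
    (heven : ∀ U : Set V, IsBSCC (G.chain σ γ) U → Even (sInf (p '' U)) →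
        ENNReal.ofReal (4 / (4 + ε)) ≤ G.winEven p α σ γ U)
    (hodd : ∀ U : Set V, IsBSCC (G.chain σ γ) U → Odd (sInf (p '' U)) →
        G.winOdd p α σ γ U ≤ ENNReal.ofReal (1 - 4 / (4 + ε))) :
    |winProb G p α σ γ (bar v) - parityVal (G.chain σ γ) p v| < ε / 2 := by
  set δ := G.chain σ γ
  set μ := G.gadgetMeasure p α σ γ (bar v)
  let oddRec : Set V := {u | ∃ U, IsBSCC δ U ∧ Odd (sInf (p '' U)) ∧ u ∈ U}
  set c := 4 / (4 + ε) with hc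
  have hc0 : 0 < c := by positivity
  have hc1 : 1 - c ≤ ε / 4 := by
    rw [hc, one_sub_div (by positivity), div_le_div_iff₀ (by positivity) (by positivity)]
    nlinarith
  have hc1' : 0 ≤ 1 - c := by
    rw [hc, one_sub_div (by positivity)]
    apply div_nonneg <;> linarith
  have hE : μ.real {π | ∃ k, π k ∈ tilde (evenRecurrent δ p)} ≤ parityVal δ p v := by
    refine measureReal_reach_tilde_le G p α σ γ _ _ (parityVal_nonneg δ p) ?_
      (fun u => (parityVal_harmonic δ p u).ge) v
    rintro u ⟨U, hU, he, hu⟩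
    exact (parityVal_of_even hU he hu).ge
  have hO : μ.real {π | ∃ k, π k ∈ tilde oddRec} ≤ 1 - parityVal δ p v := by
    refine measureReal_reach_tilde_le G p α σ γ _ (fun u => 1 - parityVal δ p u)
      (fun u => sub_nonneg.2 (parityVal_le_one δ p u)) ?_ (fun u => ?_) v
    · rintro u ⟨U, hU, ho, hu⟩
      rw [parityVal_of_odd hU ho hu, sub_zero]
    · change ∫ w, (1 - parityVal δ p w) ∂(δ u).toMeasure ≤ _
      rw [integral_sub (integrable_const _) .of_finite, ← parityVal_harmonic]
      simp
  have hC : (4 - ε) / 4 < μ.real {π | ∃ k, π k ∈ tilde (recurrent δ)} := by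
    have e : {π : ℕ → GadgetVertex V | ∃ k, π k ∈ tilde (recurrent δ)} =
        {π | ∃ U, IsBSCC δ U ∧ ∃ i, π i ∈ tilde U} := by
      ext π
      constructor
      · rintro ⟨k, ⟨u, ⟨U, hU, hu⟩, e⟩ | ⟨u, ⟨U, hU, hu⟩, e⟩⟩
        · exact ⟨U, hU, k, .inl ⟨u, hu, e⟩⟩
        · exact ⟨U, hU, k, .inr ⟨u, hu, e⟩⟩
      · rintro ⟨U, hU, k, ⟨u, hu, e⟩ | ⟨u, hu, e⟩⟩
        · exact ⟨k, .inl ⟨u, ⟨U, hU, hu⟩, e⟩⟩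
        · exact ⟨k, .inr ⟨u, ⟨U, hU, hu⟩, e⟩⟩
    rw [e]
    exact (ENNReal.ofReal_lt_iff_lt_toReal (by linarith) (measure_ne_top μ _)).1 hcross
  have hsplit : tilde (recurrent δ) ⊆ tilde (evenRecurrent δ p) ∪ tilde oddRec := by
    rintro _ (⟨u, ⟨U, hU, hu⟩, rfl⟩ | ⟨u, ⟨U, hU, hu⟩, rfl⟩) <;>
    rcases Nat.even_or_odd (sInf (p '' U)) with h | h
    · exact .inl (.inl ⟨u, ⟨U, hU, h, hu⟩, rfl⟩)
    · exact .inr (.inl ⟨u, ⟨U, hU, h, hu⟩, rfl⟩)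
    · exact .inl (.inr ⟨u, ⟨U, hU, h, hu⟩, rfl⟩)
    · exact .inr (.inr ⟨u, ⟨U, hU, h, hu⟩, rfl⟩)
  have hCEO : μ.real {π | ∃ k, π k ∈ tilde (recurrent δ)} ≤
      μ.real {π | ∃ k, π k ∈ tilde (evenRecurrent δ p)} +
        μ.real {π | ∃ k, π k ∈ tilde oddRec} := by
    refine (measureReal_mono ?_).trans (measureReal_union_le _ _)
    rintro π ⟨k, hk⟩
    exact (hsplit hk).imp (fun h => ⟨k, h⟩) fun h => ⟨k, h⟩
  have hweven : ∀ y ∈ tilde (evenRecurrent δ p), c ≤ winProb G p α σ γ y := by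
    intro y hy
    obtain ⟨U, hU, he, hyU⟩ : ∃ U, IsBSCC δ U ∧ Even (sInf (p '' U)) ∧ y ∈ tilde U := by
      rcases hy with ⟨u, ⟨U, hU, he, hu⟩, rfl⟩ | ⟨u, ⟨U, hU, he, hu⟩, rfl⟩
      · exact ⟨U, hU, he, .inl ⟨u, hu, rfl⟩⟩
      · exact ⟨U, hU, he, .inr ⟨u, hu, rfl⟩⟩
    exact (ENNReal.ofReal_le_iff_le_toReal (measure_ne_top _ _)).1
      ((heven U hU he).trans (iInf₂_le y hyU))
  have hwodd : ∀ y ∈ tilde oddRec, winProb G p α σ γ y ≤ 1 - c := by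
    intro y hy
    obtain ⟨U, hU, ho, hyU⟩ : ∃ U, IsBSCC δ U ∧ Odd (sInf (p '' U)) ∧ y ∈ tilde U := by
      rcases hy with ⟨u, ⟨U, hU, he, hu⟩, rfl⟩ | ⟨u, ⟨U, hU, he, hu⟩, rfl⟩
      · exact ⟨U, hU, he, .inl ⟨u, hu, rfl⟩⟩
      · exact ⟨U, hU, he, .inr ⟨u, hu, rfl⟩⟩
    have hle : G.gadgetMeasure p α σ γ y {π | ∃ i, π i = win} ≤ G.winOdd p α σ γ U :=
      le_iSup₂ (f := fun x _ => G.gadgetMeasure p α σ γ x {π | ∃ i, π i = win}) y hyU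
    exact ENNReal.toReal_le_of_le_ofReal hc1' (hle.trans (hodd U hU ho))
  -- Each direction loses less than `ε/4` for plays that miss all classes and at most `1 - c ≤ ε/4`
  -- inside the classes. By `hC`, `hE` and `hO`, the even classes are reached with a probability
  -- that exceeds the parity value by nothing and falls short of it by less than `ε/4`.
  have hlow := mul_measureReal_reach_le_winProb G p α σ γ _ c hc0 hweven (bar v)
  have hupp := winProb_le_of_cross G p α σ γ (tilde (recurrent δ)) (tilde (evenRecurrent δ p))
    (1 - c) hc1' (fun y hy hy' => hwodd y ((hsplit hy).resolve_left hy')) (bar v)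
  have hE1 : μ.real {π | ∃ k, π k ∈ tilde (evenRecurrent δ p)} ≤ 1 := measureReal_le_one
  have hmul := mul_le_mul_of_nonneg_left hE1 hc1'
  rw [abs_lt]
  constructor <;> linarith

end Gadget

/-! ### Denominators of the arena and the gap `ε` -/

section Denominators

variable {V : Type*} [Fintype V] (G : StochasticArena V) (b : V → V → ℕ)

theorem le_maxDenom {u w : V} (hu : G.owner u = none) (h : G.edge u w) :
    b u w ≤ G.maxDenom b := by
  classical
  refine le_trans ?_ (Finset.le_sup (Finset.mem_univ (u, w)))
  simp [h, hu]

theorem maxDenom_pos (hb : ∀ u, G.owner u = none → ∀ w, 0 < b u w) [Nonempty V] :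
    0 < G.maxDenom b := by
  classical
  obtain ⟨u⟩ := ‹Nonempty V›
  obtain ⟨w, hw⟩ := G.nonblocking u
  refine lt_of_lt_of_le ?_ (Finset.le_sup (Finset.mem_univ (u, w)))
  by_cases hu : G.owner u = none
  · simpa [hw, hu] using hb u hu w
  · simp [hw, hu]

/-- `ε` is the inverse square of the determinant bound `n! K ^ n` for row denominators up to `K = M
^ n`. -/
theorem epsilon_eq (n M : ℕ) :
    epsilon n M = 1 / ((n.factorial * (M ^ n) ^ n : ℕ) : ℝ) ^ 2 := by
  unfold epsilon
  push_cast
  ring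

theorem epsilon_pos {n M : ℕ} (hM : 0 < M) : 0 < epsilon n M := by
  have : (0 : ℝ) < M := by exact_mod_cast hM
  have : (0 : ℝ) < n.factorial := by exact_mod_cast n.factorial_pos
  unfold epsilon
  positivity

theorem epsilon_le_one {n M : ℕ} (hM : 0 < M) : epsilon n M ≤ 1 := by
  have h : 1 ≤ n.factorial * (M ^ n) ^ n := Nat.succ_le_of_lt (by positivity)
  have h' : (1 : ℝ) ≤ ((n.factorial * (M ^ n) ^ n : ℕ) : ℝ) := by exact_mod_cast h
  rw [epsilon_eq]
  exact (div_le_one (by positivity)).2 (one_le_pow₀ h')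

theorem exists_denominator_chain [MeasurableSpace V] [DiscreteMeasurableSpace V] (p : V → ℕ)
    (a : V → V → ℕ) (hb : ∀ u, G.owner u = none → ∀ w, 0 < b u w)
    (hprob : ∀ u (hu : G.owner u = none) w, G.prob u hu w = (a u w : ℝ≥0∞) / (b u w : ℝ≥0∞))
    (σ : G.PureStrategy .eve) (γ : G.PureStrategy .adam) [Nonempty V] :
    ∃ d : ℕ, 0 < d ∧
      d ≤ (Fintype.card V).factorial * (G.maxDenom b ^ Fintype.card V) ^ Fintype.card V ∧
      ∀ v, ∃ z : ℤ, parityVal (G.chain σ γ) p v * d = z := by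
  classical
  have hM := G.maxDenom_pos b hb
  -- The product over the at most `n` successors clears the row and is at most `M ^ n`.
  let D : V → ℕ := fun u =>
    if G.owner u = none then ∏ w with G.edge u w, b u w else 1
  have hpure : ∀ u w, G.chain σ γ u = PMF.pure w → D u = 1 →
      ∀ y, ∃ N : ℕ, (D u : ℝ) * (G.chain σ γ u y).toReal = N := by
    intro u w hw hD y
    rw [hw, hD, PMF.pure_apply]
    by_cases hy : y = w
    · exact ⟨1, by simp [hy]⟩
    · exact ⟨0, by simp [hy]⟩
  have hN : ∀ u y, ∃ N : ℕ, (D u : ℝ) * (G.chain σ γ u y).toReal = N := by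
    intro u y
    rcases hu : G.owner u with _ | P
    · by_cases hy : G.edge u y
      · refine ⟨a u y * ∏ w ∈ ({w | G.edge u w} : Finset V).erase y, b u w, ?_⟩
        have hD : D u = b u y * ∏ w ∈ ({w | G.edge u w} : Finset V).erase y, b u w := by
          simp only [D, hu, if_true]
          exact (Finset.mul_prod_erase _ _ (by simpa using hy)).symm
        have hb0 : (b u y : ℝ) ≠ 0 := by exact_mod_cast (hb u hu y).ne'
        rw [chain_of_random G σ γ hu, hprob u hu y, hD, ENNReal.toReal_div]
        push_cast
        simp only [ENNReal.toReal_natCast]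
        field_simp
      · refine ⟨0, ?_⟩
        rw [G.edge_iff_of_random u hu, PMF.mem_support_iff, not_not] at hy
        rw [chain_of_random G σ γ hu, hy]
        simp
    · cases P with
      | eve => exact hpure u _ (chain_of_eve G σ γ hu) (by simp [D, hu]) y
      | adam => exact hpure u _ (chain_of_adam G σ γ hu) (by simp [D, hu]) y
  choose N hN using hN
  refine exists_denominator_parityVal (G.chain σ γ) p D N _ (fun u => ?_) (fun u => ?_) hN
  · by_cases hu : G.owner u = none
    · simp only [D, hu, if_true]
      exact Finset.prod_pos fun w _ => hb u hu w
    · simp [D, hu]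
  · by_cases hu : G.owner u = none
    · simp only [D, hu, if_true]
      refine (Finset.prod_le_pow_card _ _ _ fun w hw =>
        G.le_maxDenom b hu (by simpa using hw)).trans ?_
      exact Nat.pow_le_pow_right hM (Finset.card_le_univ _)
    · simpa [D, hu] using Nat.one_le_pow _ _ hM

end Denominators

/-! ### From pure saddle points to optimality in the parity game -/

section Optimality

variable {V : Type*} [Finite V] [MeasurableSpace V] [DiscreteMeasurableSpace V]
  (G : StochasticArena V) (p : V → ℕ)

theorem playMeasure_parityObj (σ : G.Strategy .eve) (γ : G.Strategy .adam) (v : V) :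
    G.playMeasure σ γ v (G.parityObj p) = G.playMeasure σ γ v (evenSet p) :=
  playMeasure_sep_plays G σ γ v (evenSet p)

theorem playMeasure_reachObj (T : Set V) (σ : G.Strategy .eve) (γ : G.Strategy .adam) (v : V) :
    G.playMeasure σ γ v (G.reachObj T) = G.playMeasure σ γ v {π | ∃ k, π k ∈ T} :=
  playMeasure_sep_plays G σ γ v {π | ∃ k, π k ∈ T}

theorem playMeasure_plays_diff_parityObj (σ : G.Strategy .eve) (γ : G.Strategy .adam) (v : V) :
    G.playMeasure σ γ v (G.plays \ G.parityObj p) = 1 - G.playMeasure σ γ v (evenSet p) :=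
  playMeasure_plays_diff G σ γ v (measurableSet_evenSet p)

theorem playMeasure_plays_diff_reachObj (T : Set V) (σ : G.Strategy .eve) (γ : G.Strategy .adam)
    (v : V) :
    G.playMeasure σ γ v (G.plays \ G.reachObj T) = 1 - G.playMeasure σ γ v {π | ∃ k, π k ∈ T} :=
  playMeasure_plays_diff G σ γ v (measurableSet_reach T)

/-- Two pure memoryless strategies that form a saddle point among the pure memoryless strategies
form a saddle point among all strategies. -/
theorem playMeasure_evenSet_le (σ : G.PureStrategy .eve) (γ : G.PureStrategy .adam) (v : V)
    (h : ∀ (σ' : G.PureStrategy .eve) (γ' : G.PureStrategy .adam),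
      parityVal (G.chain σ' γ) p v ≤ parityVal (G.chain σ γ') p v)
    (σ' : G.Strategy .eve) (γ' : G.Strategy .adam) :
    G.playMeasure σ' γ.toStrategy v (evenSet p) ≤ G.playMeasure σ.toStrategy γ' v (evenSet p) := by
  -- Both arbitrary strategies are replaced by best responses, which are pure memoryless.
  obtain ⟨σr, hσr⟩ := exists_eve_response G p γ
  obtain ⟨γr, hγr⟩ := exists_adam_response G p σ
  exact (ENNReal.toReal_le_toReal (measure_ne_top _ _) (measure_ne_top _ _)).1
    ((hσr σ' v).trans ((h σr γr).trans (hγr γ' v)))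

theorem optimalEve_parityObj (σ : G.PureStrategy .eve) (γ : G.PureStrategy .adam) (v : V)
    (h : ∀ (σ' : G.PureStrategy .eve) (γ' : G.PureStrategy .adam),
      parityVal (G.chain σ' γ) p v ≤ parityVal (G.chain σ γ') p v) :
    G.OptimalEve (G.parityObj p) σ.toStrategy v := by
  refine le_antisymm (le_iSup (fun σ => ⨅ γ, G.playMeasure σ γ v (G.parityObj p)) σ.toStrategy)
    (iSup_le fun σ' => (iInf_le _ γ.toStrategy).trans (le_iInf fun γ' => ?_))
  rw [playMeasure_parityObj, playMeasure_parityObj]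
  exact playMeasure_evenSet_le G p σ γ v h σ' γ'

theorem optimalAdam_parityObj (σ : G.PureStrategy .eve) (γ : G.PureStrategy .adam) (v : V)
    (h : ∀ (σ' : G.PureStrategy .eve) (γ' : G.PureStrategy .adam),
      parityVal (G.chain σ' γ) p v ≤ parityVal (G.chain σ γ') p v) :
    G.OptimalAdam (G.parityObj p) γ.toStrategy v := by
  refine le_antisymm
    (le_iSup (fun γ => ⨅ σ, G.playMeasure σ γ v (G.plays \ G.parityObj p)) γ.toStrategy)
    (iSup_le fun γ' => (iInf_le _ σ.toStrategy).trans (le_iInf fun σ' => ?_))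
  rw [playMeasure_plays_diff_parityObj, playMeasure_plays_diff_parityObj]
  exact tsub_le_tsub_left (playMeasure_evenSet_le G p σ γ v h σ' γ') 1

end Optimality

/-! ### Optimal strategies as halves of saddle points -/

section ReachSaddle

variable {V : Type*} [Finite V] [MeasurableSpace V] [DiscreteMeasurableSpace V]
  {G : StochasticArena V} {t : V} {v : V}

/-- Adam's half of a saddle point holds Eve down to her value at `v`, which the optimal `σ`
guarantees; so `σ` can replace Eve's half at `v`. -/
theorem exists_adam_of_optimalEve_reachObj {σ : G.Strategy .eve}
    (h : G.OptimalEve (G.reachObj {t}) σ v) :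
    ∃ γ : G.PureStrategy .adam, ∀ (σ' : G.Strategy .eve) (γ' : G.Strategy .adam),
      G.playMeasure σ' γ.toStrategy v {π | ∃ k, π k = t} ≤
        G.playMeasure σ γ' v {π | ∃ k, π k = t} := by
  obtain ⟨σ₀, γ₀, hs⟩ := exists_reach_saddle G t
  refine ⟨γ₀, fun σ' γ' => ?_⟩
  have h1 : G.playMeasure σ' γ₀.toStrategy v {π | ∃ k, π k = t} ≤ G.valueEve (G.reachObj {t}) v :=
    le_trans (le_iInf fun γ'' => by
      rw [playMeasure_reachObj]
      exact (ENNReal.toReal_le_toReal (measure_ne_top _ _) (measure_ne_top _ _)).1 (hs σ' γ'' v))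
      (le_iSup (fun σ => ⨅ γ, G.playMeasure σ γ v (G.reachObj {t})) σ₀.toStrategy)
  rw [← h] at h1
  refine (h1.trans (iInf_le _ γ')).trans_eq ?_
  rw [playMeasure_reachObj]
  rfl

theorem exists_eve_of_optimalAdam_reachObj {γ : G.Strategy .adam}
    (h : G.OptimalAdam (G.reachObj {t}) γ v) :
    ∃ σ : G.PureStrategy .eve, ∀ (σ' : G.Strategy .eve) (γ' : G.Strategy .adam),
      G.playMeasure σ' γ v {π | ∃ k, π k = t} ≤
        G.playMeasure σ.toStrategy γ' v {π | ∃ k, π k = t} := by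
  obtain ⟨σ₀, γ₀, hs⟩ := exists_reach_saddle G t
  refine ⟨σ₀, fun σ' γ' => ?_⟩
  have h1 : 1 - G.playMeasure σ₀.toStrategy γ' v {π | ∃ k, π k = t} ≤
      G.valueAdam (G.reachObj {t}) v :=
    le_trans (le_iInf fun σ'' => by
      rw [playMeasure_plays_diff_reachObj]
      exact tsub_le_tsub_left ((ENNReal.toReal_le_toReal (measure_ne_top _ _)
        (measure_ne_top _ _)).1 (hs σ'' γ' v)) 1)
      (le_iSup (fun γ => ⨅ σ, G.playMeasure σ γ v (G.plays \ G.reachObj {t})) γ₀.toStrategy)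
  rw [← h] at h1
  have h2 := h1.trans (iInf_le _ σ')
  rw [playMeasure_plays_diff_reachObj] at h2
  exact (ENNReal.sub_le_sub_iff_left prob_le_one ENNReal.one_ne_top).1 h2

end ReachSaddle

end StochasticArena

/-! ### The reduction -/

theorem mainTheorem1 {V : Type*} [Fintype V] [MeasurableSpace V] [DiscreteMeasurableSpace V]
    (G : StochasticArena V) (p : V → ℕ) (α : ℕ → unitInterval)
    (a b : V → V → ℕ)
    (hb : ∀ u, G.owner u = none → ∀ w, 0 < b u w)
    (hprob : ∀ u (hu : G.owner u = none) w, G.prob u hu w = (a u w : ℝ≥0∞) / (b u w : ℝ≥0∞))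
    (ε : ℝ) (hε : ε = StochasticArena.epsilon (Fintype.card V) (G.maxDenom b))
    (hcross : ∀ (σ : G.PureStrategy .eve) (γ : G.PureStrategy .adam) (v : V),
      ENNReal.ofReal ((4 - ε) / 4) < G.crossPath p α σ γ v)
    (heven : ∀ (σ : G.PureStrategy .eve) (γ : G.PureStrategy .adam) (U : Set V),
      IsBSCC (G.chain σ γ) U → Even (sInf (p '' U)) →
        ENNReal.ofReal (4 / (4 + ε)) ≤ G.winEven p α σ γ U)
    (hodd : ∀ (σ : G.PureStrategy .eve) (γ : G.PureStrategy .adam) (U : Set V),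
      IsBSCC (G.chain σ γ) U → Odd (sInf (p '' U)) →
        G.winOdd p α σ γ U ≤ ENNReal.ofReal (1 - 4 / (4 + ε))) :
    (∀ (σ : G.PureStrategy .eve) (v : V),
      (G.gadget p α).OptimalEve ((G.gadget p α).reachObj {GadgetVertex.win})
          (σ.lift p α).toStrategy (GadgetVertex.bar v) →
        G.OptimalEve (G.parityObj p) σ.toStrategy v) ∧
    (∀ (γ : G.PureStrategy .adam) (v : V),
      (G.gadget p α).OptimalAdam ((G.gadget p α).reachObj {GadgetVertex.win})
          (γ.lift p α).toStrategy (GadgetVertex.bar v) →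
        G.OptimalAdam (G.parityObj p) γ.toStrategy v) := by
  -- The order of the gadget values determines that of the parity values.
  have key : ∀ (σ₁ σ₂ : G.PureStrategy .eve) (γ₁ γ₂ : G.PureStrategy .adam) (v : V),
      G.gadgetMeasure p α σ₁ γ₁ (.bar v) {π | ∃ k, π k = GadgetVertex.win} ≤
        G.gadgetMeasure p α σ₂ γ₂ (.bar v) {π | ∃ k, π k = GadgetVertex.win} →
      StochasticArena.parityVal (G.chain σ₁ γ₁) p v ≤
        StochasticArena.parityVal (G.chain σ₂ γ₂) p v := by
    intro σ₁ σ₂ γ₁ γ₂ v hle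
    have : Nonempty V := ⟨v⟩
    have hM := G.maxDenom_pos b hb
    have hε0 : 0 < ε := hε ▸ StochasticArena.epsilon_pos hM
    have hε1 : ε ≤ 1 := hε ▸ StochasticArena.epsilon_le_one hM
    have hw : StochasticArena.winProb G p α σ₁ γ₁ (.bar v) ≤
        StochasticArena.winProb G p α σ₂ γ₂ (.bar v) :=
      ENNReal.toReal_mono (measure_ne_top _ _) hle
    have h₁ := StochasticArena.abs_winProb_sub_parityVal_lt G p α σ₁ γ₁ hε0 hε1 v (hcross σ₁ γ₁ v)
      (heven σ₁ γ₁) (hodd σ₁ γ₁)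
    have h₂ := StochasticArena.abs_winProb_sub_parityVal_lt G p α σ₂ γ₂ hε0 hε1 v (hcross σ₂ γ₂ v)
      (heven σ₂ γ₂) (hodd σ₂ γ₂)
    obtain ⟨d₁, hd₁, hdL₁, hz₁⟩ := G.exists_denominator_chain b p a hb hprob σ₁ γ₁
    obtain ⟨d₂, hd₂, hdL₂, hz₂⟩ := G.exists_denominator_chain b p a hb hprob σ₂ γ₂
    obtain ⟨z₁, hz₁⟩ := hz₁ v
    obtain ⟨z₂, hz₂⟩ := hz₂ v
    -- A strict reversal would be at least `ε`, yet two errors below `ε/2` leave room for less than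
    -- `ε`.
    by_contra hlt
    have hgap := StochasticArena.one_div_sq_le_sub hd₂ hd₁ hdL₂ hdL₁ hz₂ hz₁ (not_le.1 hlt)
    rw [← StochasticArena.epsilon_eq, ← hε] at hgap
    rw [abs_lt] at h₁ h₂
    linarith
  constructor
  · intro σ v hσ
    obtain ⟨γ', hγ'⟩ := StochasticArena.exists_adam_of_optimalEve_reachObj hσ
    -- The opponent's saddle strategy lives in the gadget; surjectivity of the lift brings it back
    -- to `G`.
    obtain ⟨γ, rfl⟩ := (StochasticArena.PureStrategy.lift_bijective G .adam p α).2 γ'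
    exact StochasticArena.optimalEve_parityObj G p σ γ v fun σ'' γ'' => key _ _ _ _ v
      (hγ' (σ''.lift p α).toStrategy (γ''.lift p α).toStrategy)
  · intro γ v hγ
    obtain ⟨σ', hσ'⟩ := StochasticArena.exists_eve_of_optimalAdam_reachObj hγ
    obtain ⟨σ, rfl⟩ := (StochasticArena.PureStrategy.lift_bijective G .eve p α).2 σ'
    exact StochasticArena.optimalAdam_parityObj G p σ γ v fun σ'' γ'' => key _ _ _ _ v
      (hσ' (σ''.lift p α).toStrategy (γ''.lift p α).toStrategy)
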